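/- Let $n\ge 2$, let $S$ be hyperbolic $n$-space with origin $\mathcal O$, and let $G$ be the group of orientation-preserving isometries of $S$. A body is a nonempty connected compact subset $K\subset S$ that equals the closure of its interior. A packing by $K$ is a collection of congruent copies $gK$ ($g\in G$) of $K$ with pairwise disjoint interiors; a tiling by $K$ is a packing by $K$ whose members cover $S$. Let $\Sigma_K=\{g\in G : gK=K\}$. The set $C_K$ of all packings by $K$ carries the topology of local Hausdorff convergence (the Chabauty–Fell topology) obtained by identifying a packing $\mathcal P$ with the closed subset $\{g\Sigma_K : gK\in\mathcal P\}$ of $G/\Sigma_K$, and $G$ acts on it by $h\mathcal P=\{hA : A\in\mathcal P\}$. Let $M_I(K)$ be the set of $G$-invariant Borel probability measures on $C_K$. For $\mu\in M_I(K)$ put $$D(\mu)=\mu\Big(\Big\{\mathcal P\in C_K : \mathcal O\in\bigcup_{A\in\mathcal P}A\Big\}\Big),$$ and let the (measure-theoretic) optimal density of $K$ be $D(K)=\sup_{\mu\in M_I(K)}D(\mu)$. **Theorem 5.3.** For every $n\ge 2$ and every $\epsilon>0$ there exists a body $K$ in hyperbolic $n$-space $S$ such that $K$ admits a tiling of $S$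 but $D(K)<\epsilon$. -/

import Mathlib

open scoped Pointwise ENNReal

noncomputable section

namespace HypPacking

/-- The coordinate space `ℝⁿ⁻¹ × ℝ` containing the upper half-space model; a point is `(x, t)`. -/
abbrev Coord (n : ℕ) : Type := EuclideanSpace ℝ (Fin (n - 1)) × ℝ

/-- Hyperbolic `n`-space (`n ≥ 1`), upper half-space model: the points `(x, t)` of `ℝⁿ⁻¹ × ℝ`
with `t > 0`, with the subspace topology (which is the topology of the hyperbolic distance). -/
abbrev HypSpace (n : ℕ) : Type := {p : Coord n // 0 < p.2}

/-- The hyperbolic distance: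
`cosh d((x, t), (y, s)) = 1 + (|x - y|² + (t - s)²) / (2 t s)`. -/
def hypDist {n : ℕ} (p q : HypSpace n) : ℝ :=
  Real.arcosh (1 + (‖p.1.1 - q.1.1‖ ^ 2 + (p.1.2 - q.1.2) ^ 2) / (2 * p.1.2 * q.1.2))

/-- The distinguished point `𝒪 = (0, 1)`. -/
def origin (n : ℕ) : HypSpace n := ⟨(0, 1), one_pos⟩

/-- A self-map of the half-space, read in coordinates (and extended by the identity outside the
half-space; only its germs at points of the open half-space are used). -/
def inCoord {n : ℕ} (f : HypSpace n → HypSpace n) (v : Coord n) : Coord n :=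
  open Classical in if h : 0 < v.2 then (f ⟨v, h⟩).1 else v

/-- `f` preserves the orientation: at every point it is differentiable with a derivative of
positive determinant. -/
def OrientationPreserving {n : ℕ} (f : HypSpace n → HypSpace n) : Prop :=
  ∀ p : HypSpace n, ∃ A : Coord n →L[ℝ] Coord n, HasFDerivAt (inCoord f) A p.1 ∧ 0 < A.det

theorem inCoord_coe {n : ℕ} (f : HypSpace n → HypSpace n) (p : HypSpace n) :
    inCoord f p.1 = (f p).1 := by
  simp [inCoord, p.2]

theorem eventually_pos {n : ℕ} (p : HypSpace n) : ∀ᶠ v : Coord n in nhds p.1, 0 < v.2 :=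
  (isOpen_lt continuous_const continuous_snd).mem_nhds p.2

theorem inCoord_comp {n : ℕ} (f g : HypSpace n → HypSpace n) (v : Coord n) :
    inCoord f (inCoord g v) = inCoord (f ∘ g) v := by
  by_cases h : 0 < v.2
  · simp [inCoord, h, (g ⟨v, h⟩).2]
  · simp [inCoord, h]

theorem continuousAt_inCoord {n : ℕ} {f : HypSpace n → HypSpace n} (hf : Continuous f)
    (p : HypSpace n) : ContinuousAt (inCoord f) p.1 := by
  have ho : IsOpen {v : Coord n | 0 < v.2} := isOpen_lt continuous_const continuous_snd
  have h : ContinuousOn (inCoord f) {v : Coord n | 0 < v.2} := by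
    rw [continuousOn_iff_continuous_domRestrict]
    have e : Set.domRestrict {v : Coord n | 0 < v.2} (inCoord f) = fun p : HypSpace n => (f p).1 := by
      funext q
      exact inCoord_coe f q
    rw [e]
    exact continuous_subtype_val.comp hf
  exact h.continuousAt (ho.mem_nhds p.2)

theorem OrientationPreserving.id {n : ℕ} :
    OrientationPreserving (fun p : HypSpace n => p) := by
  intro p
  refine ⟨ContinuousLinearMap.id ℝ _, ?_, by simp [ContinuousLinearMap.det]⟩
  refine (hasFDerivAt_id p.1).congr_of_eventuallyEq ?_
  filter_upwards [eventually_pos p] with v hv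
  simp [inCoord, hv]

theorem OrientationPreserving.comp {n : ℕ} {f g : HypSpace n → HypSpace n}
    (hf : OrientationPreserving f) (hg : OrientationPreserving g) :
    OrientationPreserving (f ∘ g) := by
  intro p
  obtain ⟨A, hA, hA0⟩ := hg p
  obtain ⟨B, hB, hB0⟩ := hf (g p)
  refine ⟨B.comp A, ?_, ?_⟩
  · rw [← inCoord_coe g p] at hB
    have h := hB.comp p.1 hA
    have e : inCoord f ∘ inCoord g = inCoord (f ∘ g) := funext (inCoord_comp f g)
    rwa [e] at h
  · have : (B.comp A).det = B.det * A.det := by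
      simp [ContinuousLinearMap.det]
    rw [this]
    exact mul_pos hB0 hA0

theorem OrientationPreserving.symm {n : ℕ} {f : HypSpace n ≃ₜ HypSpace n}
    (hf : OrientationPreserving f) : OrientationPreserving f.symm := by
  intro p
  obtain ⟨A, hA, hA0⟩ := hf (f.symm p)
  let A' := A.toContinuousLinearEquivOfDetNeZero hA0.ne'
  have hAA : (A' : Coord n →L[ℝ] Coord n) = A :=
    A.coe_toContinuousLinearEquivOfDetNeZero hA0.ne'
  refine ⟨(A'.symm : Coord n →L[ℝ] Coord n), ?_, ?_⟩
  · refine HasFDerivAt.of_local_left_inverse (f := inCoord f) (f' := A')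
      (continuousAt_inCoord f.symm.continuous p) ?_ ?_
    · rw [inCoord_coe, hAA]
      exact hA
    · filter_upwards [eventually_pos p] with v hv
      rw [inCoord_comp]
      simp [inCoord, hv]
  · have h1 : A.det * (A'.symm : Coord n →L[ℝ] Coord n).det = 1 := by
      rw [← hAA]
      have : ((A' : Coord n →L[ℝ] Coord n).comp (A'.symm : Coord n →L[ℝ] Coord n)).det = 1 := by
        simp [ContinuousLinearMap.det]
      rw [← this]
      simp [ContinuousLinearMap.det]
    exact pos_of_mul_pos_right (by rw [h1]; exact one_pos) hA0.le

/-- The group `G` of orientation-preserving isometries of hyperbolic `n`-space. (An isometry is a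
homeomorphism.) -/
def IsomGroup (n : ℕ) : Subgroup (HypSpace n ≃ₜ HypSpace n) where
  carrier := {g | (∀ p q, hypDist (g p) (g q) = hypDist p q) ∧ OrientationPreserving g}
  mul_mem' := by
    rintro f g ⟨hf, hf'⟩ ⟨hg, hg'⟩
    exact ⟨fun p q => (hf (g p) (g q)).trans (hg p q), hf'.comp hg'⟩
  one_mem' := ⟨fun _ _ => rfl, OrientationPreserving.id⟩
  inv_mem' := by
    rintro g ⟨hg, hg'⟩
    refine ⟨fun p q => ?_, hg'.symm⟩
    have h := hg (g.symm p) (g.symm q)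
    rw [g.apply_symm_apply, g.apply_symm_apply] at h
    exact h.symm

/-- The action of `G` on hyperbolic space. It induces the action on subsets
(`g • K = {g • p | p ∈ K}`) and on collections of subsets. -/
instance (n : ℕ) : MulAction (IsomGroup n) (HypSpace n) where
  smul g p := g.1 p
  one_smul _ := rfl
  mul_smul _ _ _ := rfl

/-- The usual topology of `G`: pointwise convergence on hyperbolic space (for isometries this is
the same as uniform convergence on compact sets). -/
instance (n : ℕ) : TopologicalSpace (IsomGroup n) :=
  TopologicalSpace.induced (fun g (p : HypSpace n) => g • p) inferInstance

/-- A body: a nonempty connected compact set that is the closure of its interior. -/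
def IsBody {n : ℕ} (K : Set (HypSpace n)) : Prop :=
  IsConnected K ∧ IsCompact K ∧ closure (interior K) = K

/-- A packing by `K`: a collection of congruent copies of `K` with pairwise disjoint interiors. -/
def IsPacking {n : ℕ} (K : Set (HypSpace n)) (P : Set (Set (HypSpace n))) : Prop :=
  (∀ A ∈ P, ∃ g : IsomGroup n, A = g • K) ∧
    P.Pairwise fun A B => Disjoint (interior A) (interior B)

/-- A covering by `K`: a collection of congruent copies of `K` that covers the space. -/
def IsCovering {n : ℕ} (K : Set (HypSpace n)) (P : Set (Set (HypSpace n))) : Prop :=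
  (∀ A ∈ P, ∃ g : IsomGroup n, A = g • K) ∧ ∀ p, ∃ A ∈ P, p ∈ A

/-- A tiling by `K`: a packing that is also a covering. -/
def IsTiling {n : ℕ} (K : Set (HypSpace n)) (P : Set (Set (HypSpace n))) : Prop :=
  IsPacking K P ∧ IsCovering K P

/-- The space `C_K` of all packings by `K`. -/
def PackingSpace {n : ℕ} (K : Set (HypSpace n)) : Type :=
  {P : Set (Set (HypSpace n)) // IsPacking K P}

theorem interior_smul {n : ℕ} (g : IsomGroup n) (A : Set (HypSpace n)) :
    interior (g • A) = g • interior A :=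
  (g.1.image_interior A).symm

theorem IsPacking.smul {n : ℕ} {K : Set (HypSpace n)} {P : Set (Set (HypSpace n))}
    (hP : IsPacking K P) (g : IsomGroup n) : IsPacking K (g • P) := by
  constructor
  · rintro _ ⟨A, hA, rfl⟩
    obtain ⟨h, rfl⟩ := hP.1 A hA
    exact ⟨g * h, (mul_smul g h K).symm⟩
  · rintro _ ⟨A, hA, rfl⟩ _ ⟨B, hB, rfl⟩ hAB
    have hne : A ≠ B := fun h => hAB (by rw [h])
    have h := hP.2 hA hB hne
    change Disjoint (interior (g • A)) (interior (g • B))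
    rw [interior_smul, interior_smul]
    exact Set.disjoint_smul_set.2 h

/-- The action of `G` on `C_K`: `h • P = {h • A | A ∈ P}`. -/
instance {n : ℕ} (K : Set (HypSpace n)) : MulAction (IsomGroup n) (PackingSpace K) where
  smul g P := ⟨g • P.1, P.2.smul g⟩
  one_smul P := Subtype.ext (one_smul _ P.1)
  mul_smul g h P := Subtype.ext (mul_smul g h P.1)

/-- `Σ_K = {g ∈ G | g K = K}`. -/
def symmetryGroup {n : ℕ} (K : Set (HypSpace n)) : Subgroup (IsomGroup n) :=
  MulAction.stabilizer (IsomGroup n) K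

/-- The subset of `G / Σ_K` that corresponds to the packing `P`: the cosets `g Σ_K` with
`g K ∈ P`. -/
def hat {n : ℕ} {K : Set (HypSpace n)} (P : PackingSpace K) :
    Set (IsomGroup n ⧸ symmetryGroup K) :=
  {x | ∃ g : IsomGroup n, (g : IsomGroup n ⧸ symmetryGroup K) = x ∧ g • K ∈ P.1}

/-- The topology of `C_K`: local Hausdorff convergence of the closed sets `hat P ⊆ G / Σ_K`,
i.e. on every ball of `G / Σ_K` about the base point, all cosets of the one packing become
arbitrarily close to cosets of the other, and conversely. This is the Chabauty–Fell topology,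
generated by the sets of packings whose `hat` meets a given open set
and the sets of packings whose `hat` misses a given compact set. -/
instance {n : ℕ} (K : Set (HypSpace n)) : TopologicalSpace (PackingSpace K) :=
  TopologicalSpace.generateFrom
    ({W | ∃ U : Set (IsomGroup n ⧸ symmetryGroup K), IsOpen U ∧
        W = {P : PackingSpace K | (hat P ∩ U).Nonempty}} ∪
      {W | ∃ C : Set (IsomGroup n ⧸ symmetryGroup K), IsCompact C ∧
        W = {P : PackingSpace K | Disjoint (hat P) C}})

instance {n : ℕ} (K : Set (HypSpace n)) : MeasurableSpace (PackingSpace K) := borel _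

instance {n : ℕ} (K : Set (HypSpace n)) : BorelSpace (PackingSpace K) := ⟨rfl⟩

/-- `μ ∈ M_I(K)`: a Borel probability measure on `C_K` that is invariant under `G`. -/
def IsInvariantProbability {n : ℕ} {K : Set (HypSpace n)}
    (μ : MeasureTheory.Measure (PackingSpace K)) : Prop :=
  MeasureTheory.IsProbabilityMeasure μ ∧
    MeasureTheory.SMulInvariantMeasure (IsomGroup n) (PackingSpace K) μ

/-- The density `D(μ)`: the probability that the origin lies in a body of the packing. -/
def density {n : ℕ} {K : Set (HypSpace n)} (μ : MeasureTheory.Measure (PackingSpace K)) : ℝ≥0∞ :=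
  μ {P | origin n ∈ ⋃₀ P.1}

/-- The (measure-theoretic) optimal density `D(K) = sup {D(μ) | μ ∈ M_I(K)}`. -/
def optimalDensity {n : ℕ} (K : Set (HypSpace n)) : ℝ≥0∞ :=
  ⨆ (μ : MeasureTheory.Measure (PackingSpace K)) (_ : IsInvariantProbability μ), density μ

end HypPacking

end

/-!
The tile is a box with a chimney. In the upper half-space model the images of the box
`[0, 1]ⁿ⁻¹ × [1, b]` under the similarities `(x, t) ↦ (bᵏ (x + w), bᵏ t)`, with `k ∈ ℤ` and
`w ∈ ℤⁿ⁻¹`, tile the space, and every box has `bⁿ⁻¹` boxes below it, its children. From each of the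
columns of the box above its children remove a room, as large as the walls permit, and a thin
corridor down to the child; and add on top of the box the one protrusion that fills a corridor and a
room of the parent. What is left (`tile`) consists of thin walls and of one protrusion. Its images
under the same similarities still tile the space (`Admissible.exists_tiling`), but its volume is a
small fraction of the volume of its rooms.

The rooms of two copies of the tile with disjoint interiors are disjoint
(`IsChambered.disjoint_core`), in every packing and not only in the tiling above. The walls of one
tile are connected, too thick to pass through a corridor of another one, and too large to fit into
one of its rooms; so they do not enter the rooms of the other tile. If two rooms met, each would
therefore lie inside the walls around the other one, except that it might look out through the
opening of the corridor; but from a room there are two ways to the ceiling whose distance exceeds the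
size of an opening.

Hence in an invariant random packing the rooms of the tiles are disjoint, and the mass transport
principle bounds the density by the quotient of the volumes of a tile and of its rooms
(`density_mul_le`): each tile spreads the mass of its points evenly over its rooms, so the origin
sends the volume of the rooms with probability at least the density, and it never receives more than
the volume of (a neighbourhood of) a tile. The two expected masses agree (`lintegral_transport`),
since almost every point can be exchanged with the origin by an isometry. That the isometry may be
taken to preserve the orientation, up to a fixed reflection, comes from composing the reflection with
an inversion (`exists_swap`).

All comparisons of distances use `sep = 2 (cosh d - 1)`, a rational function of the coordinates, and
no triangle inequality is needed. Neighbourhoods of the tile instead of the tile itself make the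
transport relation open, which gives measurability.
-/

noncomputable section

namespace HypPacking

open Set Filter Topology MeasureTheory

variable {n : ℕ}

/-! ### The invariant `sep` of a pair of points -/

/-- The invariant `(|x - y|² + (t - s)²) / (t s)` of a pair of points `(x, t)`, `(y, s)`. It equals
`2 (cosh d - 1)`, where `d` is the hyperbolic distance, so it is a strictly increasing function of
`d`; being rational in the coordinates it is more convenient than `d`. -/
def sep {n : ℕ} (p q : HypSpace n) : ℝ :=
  (‖p.1.1 - q.1.1‖ ^ 2 + (p.1.2 - q.1.2) ^ 2) / (p.1.2 * q.1.2)

theorem sep_nonneg (p q : HypSpace n) : 0 ≤ sep p q := by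
  have := p.2
  have := q.2
  unfold sep
  positivity

theorem sep_self (p : HypSpace n) : sep p p = 0 := by simp [sep]

theorem sep_comm (p q : HypSpace n) : sep p q = sep q p := by
  unfold sep
  rw [norm_sub_rev, mul_comm q.1.2]
  ring

theorem hypDist_eq_iff (p q p' q' : HypSpace n) :
    hypDist p q = hypDist p' q' ↔ sep p q = sep p' q' := by
  have e : ∀ p q : HypSpace n, hypDist p q = Real.arcosh (1 + sep p q / 2) := fun p q => by
    unfold hypDist sep
    rw [div_div]
    congr 3
    ring
  have h1 : ∀ p q : HypSpace n, 1 + sep p q / 2 ∈ Ici (1 : ℝ) := fun p q => by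
    have := sep_nonneg p q
    simp only [mem_Ici]
    linarith
  rw [e, e]
  constructor
  · intro h
    have := Real.arcosh_injOn (h1 p q) (h1 p' q') h
    linarith
  · intro h
    rw [h]

theorem sep_smul (g : IsomGroup n) (p q : HypSpace n) : sep (g • p) (g • q) = sep p q :=
  (hypDist_eq_iff _ _ _ _).1 (g.2.1 p q)

theorem _root_.Continuous.sep {X : Type*} [TopologicalSpace X] {f g : X → HypSpace n}
    (hf : Continuous f) (hg : Continuous g) : Continuous fun x => sep (f x) (g x) := by
  unfold HypPacking.sep
  refine Continuous.div (by fun_prop) (by fun_prop) fun x => ?_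
  exact (mul_pos (f x).2 (g x).2).ne'

/-- Comparison of the hyperbolic and the Euclidean sizes of a small ball. -/
theorem abs_sub_lt_of_sep_lt {p q : HypSpace n} {r : ℝ} (hr : 0 < r) (hr1 : r ≤ 1)
    (h : sep p q < r ^ 2) :
    ‖p.1.1 - q.1.1‖ < 2 * r * p.1.2 ∧ |p.1.2 - q.1.2| < 2 * r * p.1.2 := by
  obtain ⟨⟨x, t⟩, ht⟩ := p
  obtain ⟨⟨y, s⟩, hs⟩ := q
  simp only [sep] at h ht hs ⊢
  rw [div_lt_iff₀ (mul_pos ht hs)] at h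
  set a := ‖x - y‖
  have ha : 0 ≤ a := norm_nonneg _
  have key : a ^ 2 + (t - s) ^ 2 < (2 * r * t) ^ 2 := by
    by_contra! hc
    set u := √(a ^ 2 + (t - s) ^ 2)
    have hu : u ^ 2 = a ^ 2 + (t - s) ^ 2 := Real.sq_sqrt (by positivity)
    have hu0 : 0 ≤ u := Real.sqrt_nonneg _
    have h1 : 2 * r * t ≤ u := abs_le_of_sq_le_sq' (by rw [hu]; exact hc) hu0 |>.2
    have h2 : s - t ≤ u := abs_le_of_sq_le_sq' (by rw [hu]; nlinarith [sq_nonneg a]) hu0 |>.2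
    rw [← hu] at h
    have h3 : u ^ 2 < r ^ 2 * t ^ 2 + r ^ 2 * t * u := by
      have : r ^ 2 * (t * s) ≤ r ^ 2 * (t * (t + u)) := by gcongr; linarith
      nlinarith
    have h4 : r ^ 2 * t * u ≤ r * t * u := by
      have : r ^ 2 ≤ r := by nlinarith
      gcongr
    have h5 : r * t * u < r * t * (r * t) := by nlinarith
    have h6 : u < r * t := lt_of_mul_lt_mul_left h5 (by positivity)
    nlinarith [mul_pos hr ht]
  constructor
  · exact abs_lt_of_sq_lt_sq' (by nlinarith [sq_nonneg (t - s)]) (by positivity) |>.2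
  · exact abs_lt_of_sq_lt_sq (by nlinarith [sq_nonneg a]) (by positivity)

/-- The sets `{q | sep p q < r ^ 2}` form a basis of neighbourhoods of `p`. -/
theorem exists_sep_ball_subset {p : HypSpace n} {W : Set (HypSpace n)} (hW : W ∈ 𝓝 p) :
    ∃ r > 0, ∀ q, sep p q < r → q ∈ W := by
  obtain ⟨ε, hε, hB⟩ := Metric.mem_nhds_iff.1 hW
  have hp := p.2
  set r := min 1 (ε / (2 * p.1.2)) with hr
  have hr0 : 0 < r := by positivity
  refine ⟨r ^ 2, by positivity, fun q hq => hB ?_⟩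
  obtain ⟨h1, h2⟩ := abs_sub_lt_of_sep_lt hr0 (min_le_left _ _) hq
  have h3 : 2 * r * p.1.2 ≤ ε := by
    have : r ≤ ε / (2 * p.1.2) := min_le_right _ _
    rw [le_div_iff₀ (by positivity)] at this
    linarith
  rw [Metric.mem_ball, dist_comm, Subtype.dist_eq, Prod.dist_eq, max_lt_iff, dist_eq_norm,
    Real.dist_eq]
  exact ⟨h1.trans_le h3, h2.trans_le h3⟩

theorem isOpen_sep_lt (p : HypSpace n) (r : ℝ) : IsOpen {q : HypSpace n | sep p q < r} :=
  isOpen_lt (continuous_const.sep continuous_id) continuous_const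

/-- The open neighbourhood of `K` consisting of the points at `sep` less than `r` from `K`. -/
def thickening (r : ℝ) (K : Set (HypSpace n)) : Set (HypSpace n) := {q | ∃ p ∈ K, sep p q < r}

theorem isOpen_thickening (r : ℝ) (K : Set (HypSpace n)) : IsOpen (thickening r K) := by
  have : thickening r K = ⋃ p ∈ K, {q | sep p q < r} := by
    ext q
    simp [thickening]
  rw [this]
  exact isOpen_biUnion fun p _ => isOpen_sep_lt p r

theorem subset_thickening {r : ℝ} (hr : 0 < r) (K : Set (HypSpace n)) : K ⊆ thickening r K :=
  fun p hp => ⟨p, hp, by rwa [sep_self]⟩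

theorem smul_thickening (g : IsomGroup n) (r : ℝ) (K : Set (HypSpace n)) :
    g • thickening r K = thickening r (g • K) := by
  ext q
  rw [mem_smul_set_iff_inv_smul_mem]
  constructor
  · rintro ⟨p, hp, h⟩
    refine ⟨g • p, smul_mem_smul_set hp, ?_⟩
    rwa [← sep_smul g, smul_inv_smul] at h
  · rintro ⟨_, ⟨p, hp, rfl⟩, h⟩
    refine ⟨p, hp, ?_⟩
    rw [← sep_smul g, smul_inv_smul]
    exact h

theorem continuous_smul_point (p : HypSpace n) : Continuous fun g : IsomGroup n => g • p :=
  (continuous_apply p).comp continuous_induced_dom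

/-- The map `(g, x) ↦ g⁻¹ x` is continuous: pointwise convergence of isometries suffices, since
`sep (g⁻¹ x) (h⁻¹ y) = sep x (g (h⁻¹ y))`. -/
theorem continuous_inv_smul :
    Continuous fun z : IsomGroup n × HypSpace n => z.1⁻¹ • z.2 := by
  refine continuous_iff_continuousAt.2 fun z₀ => tendsto_def.2 fun W hW => ?_
  obtain ⟨r, hr, hB⟩ := exists_sep_ball_subset hW
  have hc : Continuous fun z : IsomGroup n × HypSpace n => sep (z.1 • (z₀.1⁻¹ • z₀.2)) z.2 :=
    ((continuous_smul_point _).comp continuous_fst).sep continuous_snd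
  have ho : IsOpen {z : IsomGroup n × HypSpace n | sep (z.1 • (z₀.1⁻¹ • z₀.2)) z.2 < r} :=
    isOpen_lt hc continuous_const
  have h0 : sep (z₀.1 • (z₀.1⁻¹ • z₀.2)) z₀.2 < r := by rwa [smul_inv_smul, sep_self]
  filter_upwards [ho.mem_nhds h0] with z hz
  refine hB _ ?_
  rw [← sep_smul z.1, smul_inv_smul]
  exact hz

theorem isOpenMap_mk (Γ : Subgroup (IsomGroup n)) :
    IsOpenMap ((↑) : IsomGroup n → IsomGroup n ⧸ Γ) := by
  have : ContinuousConstSMul Γ.op (IsomGroup n) := by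
    refine ⟨fun σ => ?_⟩
    refine continuous_induced_rng.2 (continuous_pi fun p => ?_)
    have e : (fun g : IsomGroup n => (σ • g) • p) =
        fun g : IsomGroup n => g • ((MulOpposite.unop σ.1) • p) := by
      funext g
      exact mul_smul g (MulOpposite.unop σ.1) p
    exact e ▸ continuous_smul_point _
  exact isOpenMap_quotient_mk'_mul

/-! ### Hyperbolic volume -/

/-- The hyperbolic volume, with density `t⁻ⁿ` with respect to Lebesgue measure. -/
def vol (n : ℕ) : Measure (HypSpace n) :=
  Measure.comap Subtype.val
    ((volume : Measure (Coord n)).withDensity fun v => ENNReal.ofReal (v.2⁻¹ ^ n))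

theorem measurableEmbedding_val : MeasurableEmbedding (Subtype.val : HypSpace n → Coord n) :=
  MeasurableEmbedding.subtype_coe (measurableSet_lt measurable_const measurable_snd)

theorem vol_apply {s : Set (HypSpace n)} (hs : MeasurableSet s) :
    vol n s = ∫⁻ v in Subtype.val '' s, ENNReal.ofReal (v.2⁻¹ ^ n) := by
  rw [vol, measurableEmbedding_val.comap_apply,
    withDensity_apply _ (measurableEmbedding_val.measurableSet_image.2 hs)]

theorem finrank_coord (hn : 1 ≤ n) : Module.finrank ℝ (Coord n) = n := by
  rw [Module.finrank_prod]
  simp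
  omega

instance : (volume : Measure (Coord n)).IsAddHaarMeasure :=
  inferInstanceAs ((volume : Measure (EuclideanSpace ℝ (Fin (n - 1)))).prod
    (volume : Measure ℝ)).IsAddHaarMeasure

/-- The square of the Euclidean norm; `Coord n` itself carries the maximum norm. -/
def normSq (v : Coord n) : ℝ := ‖v.1‖ ^ 2 + v.2 ^ 2

theorem continuous_normSq : Continuous (normSq : Coord n → ℝ) := by
  unfold normSq
  fun_prop

theorem normSq_smul (c : ℝ) (v : Coord n) : normSq (c • v) = c ^ 2 * normSq v := by
  simp only [normSq, Prod.smul_fst, Prod.smul_snd, norm_smul, Real.norm_eq_abs, smul_eq_mul,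
    mul_pow, sq_abs]
  ring

theorem normSq_eq_zero {v : Coord n} : normSq v = 0 ↔ v = 0 := by
  constructor
  · intro h
    unfold normSq at h
    have h1 : ‖v.1‖ ^ 2 = 0 := by nlinarith [sq_nonneg v.2, sq_nonneg ‖v.1‖]
    have h2 : v.2 ^ 2 = 0 := by nlinarith [sq_nonneg v.2, sq_nonneg ‖v.1‖]
    exact Prod.ext (by simpa using h1) (by simpa using h2)
  · rintro rfl
    simp [normSq]

theorem sep_eq (p q : HypSpace n) : sep p q = normSq (p.1 - q.1) / (p.1.2 * q.1.2) := rfl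

/-- A linear map that multiplies Euclidean lengths by `c` multiplies volumes by `cⁿ`: compare the
image of the Euclidean unit ball with its dilate. -/
theorem abs_det_of_normSq (hn : 1 ≤ n) {A : Coord n →L[ℝ] Coord n} {c : ℝ} (hc : 0 < c)
    (hA : ∀ v, normSq (A v) = c ^ 2 * normSq v) : |A.det| = c ^ n := by
  have hinj : Function.Injective (A : Coord n →ₗ[ℝ] Coord n) := by
    rw [injective_iff_map_eq_zero]
    intro v hv
    have h := hA v
    rw [show A v = 0 from hv, normSq_eq_zero.2 rfl] at h
    rcases mul_eq_zero.1 h.symm with h | h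
    · exact absurd h (by positivity)
    · exact normSq_eq_zero.1 h
  have hsurj : Function.Surjective A := LinearMap.surjective_of_injective hinj
  set B : Set (Coord n) := {v | normSq v < 1}
  have hB : IsOpen B := isOpen_lt continuous_normSq continuous_const
  have hAB : A '' B = c • B := by
    ext w
    constructor
    · rintro ⟨v, hv, rfl⟩
      rw [mem_smul_set_iff_inv_smul_mem₀ hc.ne']
      change normSq _ < 1
      rw [normSq_smul, hA, ← mul_assoc, ← mul_pow, inv_mul_cancel₀ hc.ne', one_pow, one_mul]
      exact hv
    · rintro ⟨u, hu, rfl⟩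
      obtain ⟨v, hv⟩ := hsurj (c • u)
      refine ⟨v, ?_, hv⟩
      have h := hA v
      rw [hv, normSq_smul] at h
      have h' := mul_left_cancel₀ (by positivity) h
      change normSq v < 1
      rw [← h']
      exact hu
  have hpos : volume B ≠ 0 := (hB.measure_pos volume ⟨0, by simp [B, normSq]⟩).ne'
  have hfin : volume B ≠ ∞ := by
    refine (lt_of_le_of_lt (measure_mono fun v hv => ?_)
      (measure_ball_lt_top (x := (0 : Coord n)) (r := 1))).ne
    have hv : ‖v.1‖ ^ 2 + v.2 ^ 2 < 1 := hv
    rw [mem_ball_zero_iff, Prod.norm_def, max_lt_iff]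
    constructor
    · nlinarith [sq_nonneg v.2, norm_nonneg v.1]
    · rw [Real.norm_eq_abs, abs_lt]
      constructor <;> nlinarith [sq_nonneg ‖v.1‖]
  have h := Measure.addHaar_image_continuousLinearMap volume A B
  rw [hAB, Measure.addHaar_smul, finrank_coord hn, abs_of_pos (by positivity),
    ENNReal.mul_left_inj hpos hfin] at h
  exact ((ENNReal.ofReal_eq_ofReal_iff (by positivity) (abs_nonneg _)).1 h).symm

/-- The derivative of an isometry is conformal, the factor being the quotient of the heights. -/
theorem normSq_fderiv {f : HypSpace n → HypSpace n} (hf : ∀ p q, sep (f p) (f q) = sep p q)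
    (p : HypSpace n) {A : Coord n →L[ℝ] Coord n} (hA : HasFDerivAt (inCoord f) A p.1)
    (v : Coord n) : normSq (A v) = ((f p).1.2 / p.1.2) ^ 2 * normSq v := by
  -- `γ h = p + h v`; compare the difference quotients of `f ∘ γ` and of `γ` as `h → 0`
  have hγ : HasDerivAt (fun h : ℝ => p.1 + h • v) v 0 := by
    simpa using ((hasDerivAt_id (0 : ℝ)).smul_const v).const_add p.1
  have hp0 : p.1 = p.1 + (0 : ℝ) • v := by simp
  have hfγ : HasDerivAt (fun h : ℝ => inCoord f (p.1 + h • v)) (A v) 0 := by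
    rw [hp0] at hA
    exact hA.comp_hasDerivAt (0 : ℝ) hγ
  have hlim := hfγ.tendsto_slope_zero
  simp only [zero_add, ← hp0, inCoord_coe] at hlim
  have h1 : Tendsto (fun h : ℝ => normSq (h⁻¹ • (inCoord f (p.1 + h • v) - (f p).1)))
      (𝓝[≠] 0) (𝓝 (normSq (A v))) :=
    (continuous_normSq.tendsto _).comp hlim
  have hc : ContinuousAt (fun h : ℝ => inCoord f (p.1 + h • v)) 0 := hfγ.continuousAt
  have h2 : Tendsto (fun h : ℝ => normSq v *
      ((f p).1.2 * (inCoord f (p.1 + h • v)).2) / (p.1.2 * (p.1 + h • v).2))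
      (𝓝[≠] 0) (𝓝 (normSq v * ((f p).1.2 * (f p).1.2) / (p.1.2 * p.1.2))) := by
    have a1 : Tendsto (fun h : ℝ => (inCoord f (p.1 + h • v)).2) (𝓝[≠] 0) (𝓝 (f p).1.2) := by
      have := (continuous_snd.tendsto _).comp (hc.tendsto.mono_left (nhdsWithin_le_nhds (s := {0}ᶜ)))
      rwa [← hp0, inCoord_coe] at this
    have a2 : Tendsto (fun h : ℝ => (p.1 + h • v).2) (𝓝[≠] 0) (𝓝 p.1.2) := by
      have := (continuous_snd.tendsto _).comp
        (hγ.continuousAt.tendsto.mono_left (nhdsWithin_le_nhds (s := {0}ᶜ)))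
      rwa [← hp0] at this
    exact ((a1.const_mul _).const_mul _).div (a2.const_mul _) (mul_pos p.2 p.2).ne'
  have h3 : (fun h : ℝ => normSq v *
      ((f p).1.2 * (inCoord f (p.1 + h • v)).2) / (p.1.2 * (p.1 + h • v).2)) =ᶠ[𝓝[≠] 0]
      fun h : ℝ => normSq (h⁻¹ • (inCoord f (p.1 + h • v) - (f p).1)) := by
    have hev : ∀ᶠ h : ℝ in 𝓝[≠] 0, 0 < (p.1 + h • v).2 := by
      have := hγ.continuousAt.tendsto.mono_left (nhdsWithin_le_nhds (s := {0}ᶜ))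
      rw [← hp0] at this
      exact this.eventually (eventually_pos p)
    filter_upwards [hev, self_mem_nhdsWithin] with h hh hne
    have hne : h ≠ 0 := hne
    set q : HypSpace n := ⟨p.1 + h • v, hh⟩ with hq
    have e : inCoord f (p.1 + h • v) = (f q).1 := inCoord_coe f q
    have hs := hf q p
    rw [sep_eq, sep_eq, show q.1 - p.1 = h • v by simp [hq], normSq_smul,
      div_eq_div_iff (mul_pos (f q).2 (f p).2).ne' (mul_pos q.2 p.2).ne'] at hs
    rw [e, normSq_smul, show (p.1 + h • v).2 = q.1.2 from rfl,
      div_eq_iff (mul_pos p.2 q.2).ne']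
    field_simp
    linarith
  have := tendsto_nhds_unique (h2.congr' h3) h1
  rw [← this]
  have := p.2.ne'
  field_simp

theorem measurePreserving_vol (hn : 1 ≤ n) (f : HypSpace n ≃ₜ HypSpace n)
    (hf : ∀ p q, sep (f p) (f q) = sep p q)
    (hd : ∀ p : HypSpace n, ∃ A : Coord n →L[ℝ] Coord n, HasFDerivAt (inCoord f) A p.1) :
    MeasurePreserving f (vol n) (vol n) := by
  choose A hA using hd
  let A' : Coord n → Coord n →L[ℝ] Coord n := fun v =>
    open Classical in if h : 0 < v.2 then A ⟨v, h⟩ else 0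
  have hA' : ∀ p : HypSpace n, A' p.1 = A p := fun p => by simp [A', p.2]
  refine ⟨f.continuous.measurable, Measure.ext fun s hs => ?_⟩
  rw [f.measurableEmbedding.map_apply]
  set u := f ⁻¹' s with hu
  have hum : MeasurableSet u := f.continuous.measurable hs
  have himg : Subtype.val '' s = inCoord f '' (Subtype.val '' u) := by
    rw [image_image]
    have : s = f '' u := (image_preimage_eq s f.surjective).symm
    rw [this, image_image]
    exact image_congr fun p _ => (inCoord_coe f p).symm
  have hinj : InjOn (inCoord f) (Subtype.val '' u) := by
    rintro _ ⟨p, -, rfl⟩ _ ⟨q, -, rfl⟩ h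
    rw [inCoord_coe, inCoord_coe] at h
    rw [f.injective (Subtype.ext h)]
  have hum' : MeasurableSet (Subtype.val '' u) :=
    measurableEmbedding_val.measurableSet_image.2 hum
  rw [vol_apply hum, vol_apply hs, himg,
    lintegral_image_eq_lintegral_abs_det_fderiv_mul volume hum' (f' := A') ?_ hinj]
  · refine setLIntegral_congr_fun hum' ?_
    rintro _ ⟨p, -, rfl⟩
    have hp := p.2
    have hfp := (f p).2
    simp only [hA', inCoord_coe]
    rw [abs_det_of_normSq hn (div_pos hfp hp) (normSq_fderiv hf p (hA p)),
      ← ENNReal.ofReal_mul (by positivity), ← mul_pow]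
    congr 2
    field_simp
  · rintro _ ⟨p, -, rfl⟩
    rw [hA']
    exact (hA p).hasFDerivWithinAt

theorem measurePreserving_smul (hn : 1 ≤ n) (g : IsomGroup n) :
    MeasurePreserving (fun p : HypSpace n => g • p) (vol n) (vol n) :=
  measurePreserving_vol hn g.1 (sep_smul g) fun p => (g.2.2 p).imp fun _ h => h.1

theorem vol_smul (hn : 1 ≤ n) (g : IsomGroup n) (s : Set (HypSpace n)) :
    vol n (g • s) = vol n s := by
  have h := (measurePreserving_smul hn g).measure_preimage_emb g.1.measurableEmbedding (g • s)
  rw [← h]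
  congr 1
  exact ((preimage_smul g (g • s)).trans (inv_smul_smul g s))

theorem vol_absolutelyContinuous {s : Set (HypSpace n)}
    (h : volume (Subtype.val '' s) = 0) : vol n s = 0 := by
  rw [vol, measurableEmbedding_val.comap_apply]
  exact withDensity_absolutelyContinuous _ _ h

theorem vol_height_eq (c : ℝ) : vol n {p | p.1.2 = c} = 0 := by
  refine vol_absolutelyContinuous (measure_mono_null ?_
    (Measure.quasiMeasurePreserving_snd (μ := volume) (ν := volume).preimage_null
      (Real.volume_singleton (a := c))))
  rintro _ ⟨p, hp, rfl⟩
  exact hp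

theorem vol_coord_eq (i : Fin (n - 1)) (c : ℝ) : vol n {p | p.1.1 i = c} = 0 := by
  have h1 := (Measure.quasiMeasurePreserving_eval (fun _ : Fin (n - 1) => (volume : Measure ℝ))
    i).preimage_null (Real.volume_singleton (a := c))
  have h2 := (EuclideanSpace.volume_preserving_symm_measurableEquiv_toLp
    (Fin (n - 1))).quasiMeasurePreserving.preimage_null h1
  refine vol_absolutelyContinuous (measure_mono_null ?_
    (Measure.quasiMeasurePreserving_fst (μ := volume) (ν := volume).preimage_null h2))
  rintro _ ⟨p, hp, rfl⟩
  exact hp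

/-- On bounded sets away from height `0` the hyperbolic volume is finite. -/
theorem vol_lt_top {s : Set (HypSpace n)} {R a c : ℝ} (ha : 0 < a)
    (hs : ∀ p ∈ s, ‖p.1.1‖ ≤ R ∧ a ≤ p.1.2 ∧ p.1.2 ≤ c) : vol n s < ∞ := by
  rw [vol, measurableEmbedding_val.comap_apply]
  set B : Set (Coord n) := Metric.closedBall 0 R ×ˢ Icc a c
  have hB : IsCompact B := (isCompact_closedBall _ _).prod isCompact_Icc
  have hsub : Subtype.val '' s ⊆ B := by
    rintro _ ⟨p, hp, rfl⟩
    obtain ⟨h1, h2, h3⟩ := hs p hp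
    exact ⟨by simpa using h1, h2, h3⟩
  refine (measure_mono hsub).trans_lt ?_
  rw [withDensity_apply _ hB.measurableSet]
  refine setLIntegral_lt_top_of_le_nnreal hB.measure_lt_top.ne ⟨(a⁻¹ ^ n).toNNReal, ?_⟩
  rintro v ⟨-, hv, -⟩
  change ENNReal.ofReal _ ≤ ENNReal.ofReal _
  refine ENNReal.ofReal_le_ofReal ?_
  have : 0 < v.2 := ha.trans_le hv
  gcongr

instance : SigmaFinite (vol n) := by
  refine SigmaFinite.of_map (vol n) (f := Subtype.val)
    measurableEmbedding_val.measurable.aemeasurable ?_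
  rw [vol, measurableEmbedding_val.map_comap]
  infer_instance

theorem vol_pos_of_isOpen {s : Set (HypSpace n)} (hs : IsOpen s) (hne : s.Nonempty) :
    0 < vol n s := by
  rw [pos_iff_ne_zero, vol, measurableEmbedding_val.comap_apply]
  have ho : IsOpen (Subtype.val '' s) :=
    (isOpen_lt continuous_const continuous_snd).isOpenMap_subtype_val s hs
  have hpos := ho.measure_pos (volume : Measure (Coord n)) (hne.image _)
  rw [Ne, withDensity_apply_eq_zero' (by fun_prop)]
  intro h
  refine hpos.ne' (measure_mono_null ?_ h)
  rintro _ ⟨p, hp, rfl⟩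
  have := p.2
  refine ⟨?_, mem_image_of_mem _ hp⟩
  have h0 : 0 < ENNReal.ofReal (p.1.2⁻¹ ^ n) := ENNReal.ofReal_pos.2 (by positivity)
  exact h0.ne'

/-! ### Similarities, inversions and reflections -/

/-- The isometry `(x, t) ↦ (c (x + w), c t)`. -/
def affHomeo (c : ℝ) (hc : 0 < c) (w : EuclideanSpace ℝ (Fin (n - 1))) :
    HypSpace n ≃ₜ HypSpace n where
  toFun p := ⟨(c • (p.1.1 + w), c * p.1.2), mul_pos hc p.2⟩
  invFun p := ⟨(c⁻¹ • p.1.1 - w, c⁻¹ * p.1.2), mul_pos (inv_pos.2 hc) p.2⟩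
  left_inv p := Subtype.ext (Prod.ext (by simp [hc.ne']) (by simp [hc.ne']))
  right_inv p := Subtype.ext (Prod.ext (by simp [hc.ne']) (by simp [hc.ne']))
  continuous_toFun := by fun_prop
  continuous_invFun := by fun_prop

/-- `affHomeo` as an element of the isometry group. -/
def aff (c : ℝ) (hc : 0 < c) (w : EuclideanSpace ℝ (Fin (n - 1))) : IsomGroup n :=
  ⟨affHomeo c hc w, by
    constructor
    · intro p q
      rw [hypDist_eq_iff]
      have hp := p.2
      have hq := q.2
      change (‖c • (p.1.1 + w) - c • (q.1.1 + w)‖ ^ 2 + (c * p.1.2 - c * q.1.2) ^ 2) /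
        (c * p.1.2 * (c * q.1.2)) = _
      simp only [sep, ← smul_sub, norm_smul, add_sub_add_right_eq_sub, Real.norm_eq_abs,
        ← mul_sub, mul_pow, sq_abs]
      field_simp
    · intro p
      refine ⟨c • ContinuousLinearMap.id ℝ _, ?_, ?_⟩
      · have h : HasFDerivAt (fun v : Coord n => c • (v + (w, 0)))
            (c • ContinuousLinearMap.id ℝ (Coord n)) p.1 :=
          ((hasFDerivAt_id p.1).add_const _).const_smul c
        refine h.congr_of_eventuallyEq ?_
        filter_upwards [eventually_pos p] with v hv
        rw [inCoord_coe _ ⟨v, hv⟩]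
        exact Prod.ext (by simp [affHomeo]) (by simp [affHomeo])
      · simp only [ContinuousLinearMap.det, ContinuousLinearMap.toLinearMap_smul,
          ContinuousLinearMap.coe_id, LinearMap.det_smul, LinearMap.det_id]
        positivity⟩

theorem aff_smul_fst (c : ℝ) (hc : 0 < c) (w : EuclideanSpace ℝ (Fin (n - 1)))
    (p : HypSpace n) : (aff c hc w • p).1.1 = c • (p.1.1 + w) := rfl

theorem aff_smul_snd (c : ℝ) (hc : 0 < c) (w : EuclideanSpace ℝ (Fin (n - 1)))
    (p : HypSpace n) : (aff c hc w • p).1.2 = c * p.1.2 := rfl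

/-- The reflection of `Coord n` that changes the sign of the `i`-th horizontal coordinate. -/
def reflCoord (i : Fin (n - 1)) (v : Coord n) : Coord n :=
  v + (-2 * v.1 i) • (EuclideanSpace.single i 1, 0)

theorem reflCoord_apply (i j : Fin (n - 1)) (v : Coord n) :
    (reflCoord i v).1 j = if j = i then -v.1 j else v.1 j := by
  by_cases h : j = i
  · subst h
    simp [reflCoord]
    ring
  · simp [reflCoord, h]

theorem reflCoord_snd (i : Fin (n - 1)) (v : Coord n) : (reflCoord i v).2 = v.2 := by
  simp [reflCoord]

theorem reflCoord_reflCoord (i : Fin (n - 1)) (v : Coord n) :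
    reflCoord i (reflCoord i v) = v := by
  refine Prod.ext (PiLp.ext fun j => ?_) (by simp [reflCoord_snd])
  rw [reflCoord_apply, reflCoord_apply]
  split_ifs <;> simp

theorem reflCoord_sub (i : Fin (n - 1)) (v w : Coord n) :
    reflCoord i (v - w) = reflCoord i v - reflCoord i w := by
  refine Prod.ext (PiLp.ext fun j => ?_) (by simp [reflCoord_snd])
  rw [Prod.fst_sub, PiLp.sub_apply, reflCoord_apply, reflCoord_apply, reflCoord_apply]
  split_ifs
  · simp
    ring
  · simp

theorem reflCoord_smul (i : Fin (n - 1)) (c : ℝ) (v : Coord n) :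
    reflCoord i (c • v) = c • reflCoord i v := by
  refine Prod.ext (PiLp.ext fun j => ?_) (by simp [reflCoord_snd])
  rw [Prod.smul_fst, PiLp.smul_apply, reflCoord_apply, reflCoord_apply]
  split_ifs <;> simp

theorem normSq_reflCoord (i : Fin (n - 1)) (v : Coord n) : normSq (reflCoord i v) = normSq v := by
  unfold normSq
  rw [reflCoord_snd, EuclideanSpace.norm_eq, EuclideanSpace.norm_eq]
  congr 3
  refine Finset.sum_congr rfl fun j _ => ?_
  rw [reflCoord_apply]
  split_ifs <;> simp

/-- The reflection as a map of hyperbolic space. It reverses the orientation. -/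
def refl (i : Fin (n - 1)) : HypSpace n ≃ₜ HypSpace n where
  toFun p := ⟨reflCoord i p.1, by rw [reflCoord_snd]; exact p.2⟩
  invFun p := ⟨reflCoord i p.1, by rw [reflCoord_snd]; exact p.2⟩
  left_inv p := Subtype.ext (reflCoord_reflCoord i p.1)
  right_inv p := Subtype.ext (reflCoord_reflCoord i p.1)
  continuous_toFun := by unfold reflCoord; fun_prop
  continuous_invFun := by unfold reflCoord; fun_prop

theorem sep_refl (i : Fin (n - 1)) (p q : HypSpace n) : sep (refl i p) (refl i q) = sep p q := by
  rw [sep_eq, sep_eq]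
  change normSq (reflCoord i p.1 - reflCoord i q.1) /
    ((reflCoord i p.1).2 * (reflCoord i q.1).2) = _
  rw [← reflCoord_sub, normSq_reflCoord, reflCoord_snd, reflCoord_snd]

theorem hasFDerivAt_refl (i : Fin (n - 1)) (p : HypSpace n) :
    ∃ A : Coord n →L[ℝ] Coord n, HasFDerivAt (inCoord (refl i)) A p.1 ∧ A.det < 0 := by
  let f : Coord n →L[ℝ] ℝ :=
    (-2 : ℝ) • ((EuclideanSpace.proj i).comp (ContinuousLinearMap.fst ℝ _ ℝ))
  let A : Coord n →L[ℝ] Coord n :=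
    ContinuousLinearMap.id ℝ _ + f.smulRight (EuclideanSpace.single i 1, 0)
  have hA : ∀ v, A v = reflCoord i v := fun v => by simp [A, f, reflCoord]
  refine ⟨A, ?_, ?_⟩
  · refine A.hasFDerivAt.congr_of_eventuallyEq ?_
    filter_upwards [eventually_pos p] with v hv
    rw [inCoord_coe _ ⟨v, hv⟩, hA]
    rfl
  · have : (A : Coord n →ₗ[ℝ] Coord n) =
        LinearMap.transvection (f : Coord n →ₗ[ℝ] ℝ) (EuclideanSpace.single i 1, 0) := by
      ext v <;> rfl
    rw [ContinuousLinearMap.det, this, LinearMap.transvection.det]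
    simp [f]

theorem normSq_pos (p : HypSpace n) : 0 < normSq p.1 := by
  have := p.2
  unfold normSq
  positivity

/-- The inversion `p ↦ p / |p|²` in the unit hemisphere. It reverses the orientation. -/
def inversion (n : ℕ) : HypSpace n ≃ₜ HypSpace n :=
  let J : HypSpace n → HypSpace n := fun p =>
    ⟨(normSq p.1)⁻¹ • p.1, mul_pos (inv_pos.2 (normSq_pos p)) p.2⟩
  have hJ : ∀ p, J (J p) = p := fun p => by
    refine Subtype.ext ?_
    change (normSq ((normSq p.1)⁻¹ • p.1))⁻¹ • ((normSq p.1)⁻¹ • p.1) = p.1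
    have := (normSq_pos p).ne'
    rw [normSq_smul, smul_smul]
    field_simp
    simp
  have hc : Continuous J :=
    Continuous.subtype_mk (((continuous_normSq.comp continuous_subtype_val).inv₀
      fun p => (normSq_pos p).ne').smul continuous_subtype_val) _
  ⟨⟨J, J, hJ, hJ⟩, hc, hc⟩

theorem inversion_coe (p : HypSpace n) : (inversion n p).1 = (normSq p.1)⁻¹ • p.1 := rfl

theorem normSq_sub (v w : Coord n) :
    normSq (v - w) = normSq v - 2 * (inner ℝ v.1 w.1 + v.2 * w.2) + normSq w := by
  simp only [normSq, Prod.fst_sub, Prod.snd_sub, norm_sub_sq_real]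
  ring

theorem sep_inversion (p q : HypSpace n) : sep (inversion n p) (inversion n q) = sep p q := by
  rw [sep_eq, sep_eq, inversion_coe, inversion_coe, normSq_sub, normSq_sub, normSq_smul,
    normSq_smul]
  simp only [Prod.smul_fst, Prod.smul_snd, inner_smul_left, inner_smul_right, smul_eq_mul,
    conj_trivial]
  have hp := normSq_pos p
  have hq := normSq_pos q
  have := p.2
  have := q.2
  field_simp
  ring

theorem hasFDerivAt_inversion (p : HypSpace n) :
    ∃ A : Coord n →L[ℝ] Coord n, HasFDerivAt (inCoord (inversion n)) A p.1 ∧ A.det < 0 := by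
  have hN := normSq_pos p
  let d : Coord n →L[ℝ] ℝ :=
    (2 : ℝ) • ((innerSL ℝ p.1.1).comp (ContinuousLinearMap.fst ℝ _ ℝ)) +
      (2 * p.1.2) • ContinuousLinearMap.snd ℝ _ ℝ
  have hd : HasFDerivAt (normSq : Coord n → ℝ) d p.1 := by
    have h1 : HasFDerivAt (fun v : Coord n => ‖v.1‖ ^ 2) _ p.1 :=
      (hasFDerivAt_fst (𝕜 := ℝ) (p := p.1)).norm_sq
    have h2 : HasFDerivAt (fun v : Coord n => v.2 ^ 2) _ p.1 :=
      (hasFDerivAt_snd (𝕜 := ℝ) (p := p.1)).pow 2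
    refine (h1.add h2).congr_fderiv ?_
    ext v <;> simp [d]
  have hinv : HasFDerivAt (fun v : Coord n => (normSq v)⁻¹)
      (-((normSq p.1 ^ 2)⁻¹ • d)) p.1 := by
    refine ((hasDerivAt_inv hN.ne').comp_hasFDerivAt p.1 hd).congr_fderiv ?_
    ext v <;> simp
  have hsm := hinv.smul (hasFDerivAt_id p.1)
  refine ⟨_, hsm.congr_of_eventuallyEq ?_, ?_⟩
  · filter_upwards [eventually_pos p] with v hv
    rw [inCoord_coe _ ⟨v, hv⟩]
    rfl
  · have : ((((normSq p.1)⁻¹ • ContinuousLinearMap.id ℝ (Coord n) +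
        (-((normSq p.1 ^ 2)⁻¹ • d)).smulRight (id p.1) : Coord n →L[ℝ] Coord n)) :
          Coord n →ₗ[ℝ] Coord n) =
        (normSq p.1)⁻¹ •
          LinearMap.transvection ((-(normSq p.1)⁻¹ • d : Coord n →L[ℝ] ℝ) : Coord n →ₗ[ℝ] ℝ)
            p.1 := by
      refine LinearMap.ext fun v => ?_
      simp only [ContinuousLinearMap.coe_coe, add_apply,
        smul_apply, ContinuousLinearMap.smulRight_apply,
        neg_apply, ContinuousLinearMap.id_apply, LinearMap.smul_apply,
        LinearMap.transvection.apply, id, smul_eq_mul, smul_add, smul_smul]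
      congr 2
      field_simp
    rw [ContinuousLinearMap.det, this, LinearMap.det_smul, LinearMap.transvection.det]
    have hdp : d p.1 = 2 * normSq p.1 := by
      simp [d, normSq]
      ring
    have : (1 : ℝ) + ((-(normSq p.1)⁻¹ • d : Coord n →L[ℝ] ℝ) : Coord n →ₗ[ℝ] ℝ) p.1 = -1 := by
      simp only [ContinuousLinearMap.coe_coe, smul_apply, hdp, smul_eq_mul]
      field_simp
      norm_num
    rw [this]
    have : 0 < (normSq p.1)⁻¹ ^ Module.finrank ℝ (Coord n) := by positivity
    linarith

/-- The composition of the unit inversion and a reflection, which preserves the orientation. -/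
def inversionRefl (i : Fin (n - 1)) : IsomGroup n :=
  ⟨(refl i).trans (inversion n), by
    constructor
    · intro p q
      rw [hypDist_eq_iff]
      exact (sep_inversion _ _).trans (sep_refl i p q)
    · intro p
      obtain ⟨A, hA, hA0⟩ := hasFDerivAt_refl i p
      obtain ⟨B, hB, hB0⟩ := hasFDerivAt_inversion (refl i p)
      refine ⟨B.comp A, ?_, ?_⟩
      · rw [← inCoord_coe (refl i) p] at hB
        have h := hB.comp p.1 hA
        have e : inCoord (inversion n) ∘ inCoord (refl i) =
            inCoord ((refl i).trans (inversion n)) := funext (inCoord_comp _ _)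
        rwa [e] at h
      · have : (B.comp A).det = B.det * A.det := by simp [ContinuousLinearMap.det]
        rw [this]
        exact mul_pos_of_neg_of_neg hB0 hA0⟩

theorem inversionRefl_smul (i : Fin (n - 1)) (p : HypSpace n) :
    (inversionRefl i • p).1 = (normSq p.1)⁻¹ • reflCoord i p.1 := by
  change (normSq (reflCoord i p.1))⁻¹ • reflCoord i p.1 = _
  rw [normSq_reflCoord]

theorem refl_origin (i : Fin (n - 1)) : refl i (origin n) = origin n := by
  refine Subtype.ext (Prod.ext (PiLp.ext fun j => ?_) ?_)
  · change (reflCoord i (0, 1)).1 j = _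
    rw [reflCoord_apply]
    simp [origin]
  · exact reflCoord_snd i _

/-- Up to a fixed reflection, any point at height `≠ 1` can be exchanged with the origin by an
orientation-preserving isometry: compose the reflection with the inversion in the hemisphere that
bisects the two points. -/
theorem exists_swap (i : Fin (n - 1)) (y : HypSpace n) (hy : y.1.2 ≠ 1) :
    ∃ g : IsomGroup n, g • origin n = y ∧ g • refl i y = origin n := by
  obtain ⟨⟨x, t⟩, ht⟩ := y
  simp only at ht hy
  have h1t : 1 - t ≠ 0 := sub_ne_zero.2 hy.symm
  -- the centre `c` and the radius `r` of the hemisphere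
  set c : EuclideanSpace ℝ (Fin (n - 1)) := (1 - t)⁻¹ • x with hc
  have hx : x = (1 - t) • c := by rw [hc, smul_smul, mul_inv_cancel₀ h1t, one_smul]
  have hpos : 0 < t * (‖c‖ ^ 2 + 1) := by positivity
  set r : ℝ := √(t * (‖c‖ ^ 2 + 1)) with hr
  have hr0 : 0 < r := Real.sqrt_pos.2 hpos
  have hr2 : r ^ 2 = t * (‖c‖ ^ 2 + 1) := Real.sq_sqrt hpos.le
  set c' : EuclideanSpace ℝ (Fin (n - 1)) := (reflCoord i (c, 0)).1 with hc'
  have hcc : ((c', 0) : Coord n) = reflCoord i (c, 0) := Prod.ext rfl (reflCoord_snd i (c, 0)).symm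
  set g : IsomGroup n := aff 1 one_pos c * (aff r hr0 0 * (inversionRefl i *
    (aff r⁻¹ (inv_pos.2 hr0) 0 * aff 1 one_pos (-c')))) with hg
  have key : ∀ p : HypSpace n, (g • refl i p).1 =
      (c, 0) + (r ^ 2 * (normSq (p.1 - (c, 0)))⁻¹) • (p.1 - (c, 0)) := by
    intro p
    set q : HypSpace n := aff (n := n) r⁻¹ (inv_pos.2 hr0) 0 •
      aff (n := n) 1 one_pos (-c') • refl i p with hq
    have e1 : q.1 = r⁻¹ • reflCoord i (p.1 - (c, 0)) := by
      rw [reflCoord_sub, ← hcc]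
      refine Prod.ext ?_ ?_
      · rw [hq, aff_smul_fst, aff_smul_fst]
        change _ = r⁻¹ • ((reflCoord i p.1).1 - c')
        rw [one_smul, add_zero, sub_eq_add_neg]
        rfl
      · rw [hq, aff_smul_snd, aff_smul_snd]
        change _ = r⁻¹ * ((reflCoord i p.1).2 - 0)
        rw [one_mul, sub_zero]
        rfl
    have e2 : (inversionRefl i • q).1 =
        (r * (normSq (p.1 - (c, 0)))⁻¹) • (p.1 - (c, 0)) := by
      rw [inversionRefl_smul, e1, normSq_smul, normSq_reflCoord, reflCoord_smul,
        reflCoord_reflCoord, smul_smul]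
      congr 1
      rw [mul_inv]
      field_simp
    have e3 : g • refl i p =
        aff (n := n) 1 one_pos c • aff (n := n) r hr0 0 • inversionRefl i • q := by
      simp only [hg, hq, mul_smul]
    rw [e3]
    refine Prod.ext ?_ ?_
    · rw [aff_smul_fst, aff_smul_fst, e2, one_smul, add_zero, Prod.smul_fst, smul_smul, add_comm,
        Prod.fst_add, Prod.smul_fst]
      congr 2
      ring
    · rw [aff_smul_snd, aff_smul_snd, e2]
      simp only [Prod.smul_snd, Prod.snd_add, smul_eq_mul, Prod.snd_sub]
      ring
  refine ⟨g, Subtype.ext ?_, Subtype.ext ?_⟩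
  · have h := key (origin n)
    rw [refl_origin] at h
    rw [h]
    have hN : normSq ((origin n).1 - (c, 0)) = ‖c‖ ^ 2 + 1 := by simp [normSq, origin]
    have hN0 : ‖c‖ ^ 2 + 1 ≠ 0 := by positivity
    rw [hN, hr2, mul_assoc, mul_inv_cancel₀ hN0, mul_one]
    refine Prod.ext ?_ ?_
    · simp only [origin, Prod.fst_add, Prod.smul_fst, Prod.fst_sub, zero_sub]
      rw [hx]
      module
    · simp [origin]
  · rw [key]
    have e : (((x, t) : Coord n) - (c, 0)) = (t • (-c), t) := by
      refine Prod.ext ?_ (by simp)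
      simp only [Prod.fst_sub]
      rw [hx]
      module
    have hN : normSq ((t • (-c), t) : Coord n) = t ^ 2 * (‖c‖ ^ 2 + 1) := by
      simp only [normSq, norm_smul, norm_neg, Real.norm_eq_abs, mul_pow, sq_abs]
      ring
    have hN0 : ‖c‖ ^ 2 + 1 ≠ 0 := by positivity
    have hco : r ^ 2 * (t ^ 2 * (‖c‖ ^ 2 + 1))⁻¹ = t⁻¹ := by
      rw [hr2]
      field_simp
    rw [e, hN, hco]
    refine Prod.ext ?_ ?_
    · simp only [origin, Prod.fst_add, Prod.smul_fst, smul_smul, inv_mul_cancel₀ ht.ne', one_smul]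
      simp
    · simp [origin, ht.ne']

/-! ### Mass transport -/

/-- The relation behind the mass transport: for some member `gK` of the packing, `x` lies in `gN`
and `y` in `gC`. -/
def transport (K N C : Set (HypSpace n)) (P : PackingSpace K) (x y : HypSpace n) : Prop :=
  ∃ g : IsomGroup n, g • K ∈ P.1 ∧ x ∈ g • N ∧ y ∈ g • C

theorem isOpen_transport (K : Set (HypSpace n)) {N C : Set (HypSpace n)} (hN : IsOpen N)
    (hC : IsOpen C) :
    IsOpen {z : PackingSpace K × HypSpace n × HypSpace n | transport K N C z.1 z.2.1 z.2.2} := by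
  rw [isOpen_iff_mem_nhds]
  rintro ⟨P₀, x₀, y₀⟩ ⟨g₀, hg, hx, hy⟩
  have hx' : Continuous fun z : IsomGroup n × HypSpace n × HypSpace n => z.1⁻¹ • z.2.1 :=
    continuous_inv_smul.comp (continuous_fst.prodMk (continuous_fst.comp continuous_snd))
  have hy' : Continuous fun z : IsomGroup n × HypSpace n × HypSpace n => z.1⁻¹ • z.2.2 :=
    continuous_inv_smul.comp (continuous_fst.prodMk (continuous_snd.comp continuous_snd))
  have hV := (hN.preimage hx').inter (hC.preimage hy')
  obtain ⟨V, W, hVo, hWo, hgV, hxyW, hVW⟩ := isOpen_prod_iff.1 hV g₀ (x₀, y₀)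
    ⟨mem_smul_set_iff_inv_smul_mem.1 hx, mem_smul_set_iff_inv_smul_mem.1 hy⟩
  -- the packings whose set of cosets meets the image of `V` form an open set
  have hQ : IsOpen {P : PackingSpace K |
      (hat P ∩ ((↑) : IsomGroup n → IsomGroup n ⧸ symmetryGroup K) '' V).Nonempty} :=
    TopologicalSpace.isOpen_generateFrom_of_mem (Or.inl ⟨_, isOpenMap_mk _ V hVo, rfl⟩)
  have hmem : P₀ ∈ {P : PackingSpace K |
      (hat P ∩ ((↑) : IsomGroup n → IsomGroup n ⧸ symmetryGroup K) '' V).Nonempty} :=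
    ⟨g₀, ⟨g₀, rfl, hg⟩, ⟨g₀, hgV, rfl⟩⟩
  refine mem_of_superset ((hQ.prod hWo).mem_nhds ⟨hmem, hxyW⟩) ?_
  rintro ⟨P, x, y⟩ ⟨⟨_, ⟨g, rfl, hgP⟩, ⟨h, hhV, hgh⟩⟩, hxy⟩
  have hK : h • K = g • K := by
    have hs : h⁻¹ * g ∈ symmetryGroup K := QuotientGroup.eq.1 hgh
    have hs : (h⁻¹ * g) • K = K := hs
    rw [mul_smul] at hs
    rw [← hs, smul_inv_smul, hs]
  have := hVW (⟨hhV, hxy⟩ : (h, (x, y)) ∈ V ×ˢ W)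
  exact ⟨h, hK ▸ hgP, mem_smul_set_iff_inv_smul_mem.2 this.1,
    mem_smul_set_iff_inv_smul_mem.2 this.2⟩

theorem transport_smul {K N C : Set (HypSpace n)} (h : IsomGroup n) (P : PackingSpace K)
    (x y : HypSpace n) : transport K N C (h • P) (h • x) (h • y) ↔ transport K N C P x y := by
  constructor
  · rintro ⟨g, hg, hx, hy⟩
    refine ⟨h⁻¹ * g, ?_, ?_, ?_⟩
    · rw [mul_smul]
      exact mem_smul_set_iff_inv_smul_mem.1 hg
    · rwa [mul_smul, mem_smul_set_iff_inv_smul_mem, inv_inv]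
    · rwa [mul_smul, mem_smul_set_iff_inv_smul_mem, inv_inv]
  · rintro ⟨g, hg, hx, hy⟩
    refine ⟨h * g, ?_, ?_, ?_⟩
    · rw [mul_smul]
      exact smul_mem_smul_set hg
    · rw [mul_smul]
      exact smul_mem_smul_set hx
    · rw [mul_smul]
      exact smul_mem_smul_set hy

/-- The mass transport principle: under an invariant random packing, the expected mass sent from the
origin equals the expected mass that it receives. The probability that `x` sends mass to `y` is an
invariant function of `(x, y)`, hence it is symmetric up to a reflection of one argument, as almost
every point can be exchanged with the origin. -/
theorem lintegral_transport (hn : 2 ≤ n) {K N C : Set (HypSpace n)} (hN : IsOpen N)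
    (hC : IsOpen C) (μ : Measure (PackingSpace K)) (hμ : IsInvariantProbability μ) :
    ∫⁻ P, vol n {y | transport K N C P (origin n) y} ∂μ =
      ∫⁻ P, vol n {x | transport K N C P x (origin n)} ∂μ := by
  have := hμ.1
  have := hμ.2
  have hE := isOpen_transport K hN hC
  have hP : ∀ x y, MeasurableSet {P | transport K N C P x y} := fun x y =>
    (hE.preimage (by fun_prop : Continuous fun P : PackingSpace K => (P, x, y))).measurableSet
  have hinv : ∀ (g : IsomGroup n) (x y),
      μ {P | transport K N C P (g • x) (g • y)} = μ {P | transport K N C P x y} := by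
    intro g x y
    rw [← SMulInvariantMeasure.measure_preimage_smul g (hP (g • x) (g • y))]
    congr 1
    ext P
    exact transport_smul g P x y
  have h1 : MeasurableSet {z : PackingSpace K × HypSpace n | transport K N C z.1 (origin n) z.2} :=
    (hE.preimage (by fun_prop : Continuous fun z : PackingSpace K × HypSpace n =>
      (z.1, origin n, z.2))).measurableSet
  have h2 : MeasurableSet {z : PackingSpace K × HypSpace n | transport K N C z.1 z.2 (origin n)} :=
    (hE.preimage (by fun_prop : Continuous fun z : PackingSpace K × HypSpace n =>
      (z.1, z.2, origin n))).measurableSet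
  have e1 := (Measure.prod_apply (μ := μ) (ν := vol n) h1).symm.trans (Measure.prod_apply_symm h1)
  have e2 := (Measure.prod_apply (μ := μ) (ν := vol n) h2).symm.trans (Measure.prod_apply_symm h2)
  let i : Fin (n - 1) := ⟨0, by omega⟩
  have hρ : MeasurePreserving (refl (n := n) i) (vol n) (vol n) :=
    measurePreserving_vol (by omega) _ (sep_refl i) fun p => (hasFDerivAt_refl i p).imp
      fun _ h => h.1
  refine (e1.trans (lintegral_congr_ae ?_)).trans
    ((hρ.lintegral_comp_emb (refl i).measurableEmbedding _).trans e2.symm)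
  have hae : ∀ᵐ y ∂(vol n), y.1.2 ≠ 1 := by
    rw [ae_iff]
    simpa using vol_height_eq (n := n) 1
  filter_upwards [hae] with y hy
  obtain ⟨g, hg1, hg2⟩ := exists_swap i y hy
  have := hinv g (refl i y) (origin n)
  rw [hg1, hg2] at this
  exact this

/-- If congruent copies of `K` with disjoint interiors always have disjoint copies of `C`, then
every invariant packing has density at most `vol N / vol C`, for each neighbourhood `N` of `K`: let
every member of the packing spread mass from its neighbourhood over its copy of `C`. A point sends
at least `vol C` if it is covered, and it receives at most `vol N`. -/
theorem density_mul_le (hn : 2 ≤ n) {K C : Set (HypSpace n)} (hC : IsOpen C)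
    (hsep : ∀ g h : IsomGroup n, Disjoint (interior (g • K)) (interior (h • K)) →
      Disjoint (g • C) (h • C)) {r : ℝ} (hr : 0 < r)
    (μ : Measure (PackingSpace K)) (hμ : IsInvariantProbability μ) :
    density μ * vol n C ≤ vol n (thickening r K) := by
  have := hμ.1
  have h1n : 1 ≤ n := by omega
  have hN := isOpen_thickening r K
  have hE := isOpen_transport K hN hC
  set Q : Set (PackingSpace K) := {P | ∃ g : IsomGroup n, g • K ∈ P.1 ∧
    origin n ∈ g • thickening r K} with hQ
  have hQm : MeasurableSet Q := by
    have hE' := isOpen_transport K hN isOpen_univ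
    have e : Q = (fun P : PackingSpace K => (P, origin n, origin n)) ⁻¹'
        {z : PackingSpace K × HypSpace n × HypSpace n |
          transport K (thickening r K) univ z.1 z.2.1 z.2.2} := by
      ext P
      simp [hQ, transport]
    rw [e]
    exact (hE'.preimage (by fun_prop)).measurableSet
  have hDQ : density μ ≤ μ Q := by
    refine measure_mono ?_
    rintro P ⟨A, hA, hO⟩
    obtain ⟨g, rfl⟩ := P.2.1 A hA
    exact ⟨g, hA, smul_set_mono (subset_thickening hr K) hO⟩
  calc density μ * vol n C ≤ vol n C * μ Q := by rw [mul_comm]; gcongr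
    _ = ∫⁻ P, Q.indicator (fun _ => vol n C) P ∂μ := by
        rw [lintegral_indicator hQm, setLIntegral_const]
    _ ≤ ∫⁻ P, vol n {y | transport K (thickening r K) C P (origin n) y} ∂μ := by
        refine lintegral_mono fun P => ?_
        by_cases hP : P ∈ Q
        · rw [indicator_of_mem hP]
          obtain ⟨g, hg, hO⟩ := hP
          rw [← vol_smul h1n g C]
          exact measure_mono fun y hy => ⟨g, hg, hO, hy⟩
        · rw [indicator_of_notMem hP]
          exact zero_le
    _ = ∫⁻ P, vol n {x | transport K (thickening r K) C P x (origin n)} ∂μ :=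
        lintegral_transport hn hN hC μ hμ
    _ ≤ ∫⁻ _, vol n (thickening r K) ∂μ := by
        refine lintegral_mono fun P => ?_
        by_cases h : ∃ g : IsomGroup n, g • K ∈ P.1 ∧ origin n ∈ g • C
        · obtain ⟨g, hg, hO⟩ := h
          rw [← vol_smul h1n g (thickening r K)]
          refine measure_mono ?_
          rintro x ⟨g', hg', hx, hO'⟩
          -- the two members have a common point in their copies of `C`, so they coincide
          have e : g' • K = g • K := by
            by_contra hne
            exact disjoint_left.1 (hsep _ _ (P.2.2 hg' hg hne)) hO' hO
          rwa [smul_thickening, e, ← smul_thickening] at hx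
        · have : {x | transport K (thickening r K) C P x (origin n)} = ∅ := by
            refine eq_empty_of_forall_notMem ?_
            rintro x ⟨g, hg, -, hO⟩
            exact h ⟨g, hg, hO⟩
          rw [this]
          simp
    _ = vol n (thickening r K) := by simp

/-- The thickenings of a compact set shrink to it, also in volume. -/
theorem exists_vol_thickening_lt {K : Set (HypSpace n)} (hK : IsCompact K) {v : ℝ≥0∞}
    (hv : vol n K < v) : ∃ r > 0, vol n (thickening r K) < v := by
  rcases K.eq_empty_or_nonempty with rfl | hne
  · exact ⟨1, one_pos, by simpa [thickening] using hv⟩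
  obtain ⟨p₁, -, h₁⟩ := hK.exists_isMinOn hne
    (by fun_prop : Continuous fun p : HypSpace n => p.1.2).continuousOn
  obtain ⟨p₂, -, h₂⟩ := hK.exists_isMaxOn hne
    (by fun_prop : Continuous fun p : HypSpace n => p.1.2).continuousOn
  obtain ⟨p₃, -, h₃⟩ := hK.exists_isMaxOn hne
    (by fun_prop : Continuous fun p : HypSpace n => ‖p.1.1‖).continuousOn
  -- the members of a decreasing sequence of thickenings, and a bound for the first one
  let r : ℕ → ℝ := fun j => (1 / 4 / (j + 1)) ^ 2
  have hr0 : ∀ j, 0 < r j := fun j => by positivity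
  have hranti : Antitone r := fun j k hjk => by
    have : (j : ℝ) ≤ k := by exact_mod_cast hjk
    simp only [r]
    gcongr
  have hanti : Antitone fun j => thickening (r j) K := by
    rintro j k hjk x ⟨p, hp, h⟩
    exact ⟨p, hp, h.trans_le (hranti hjk)⟩
  have hfin : vol n (thickening (r 0) K) < ∞ := by
    refine vol_lt_top (R := ‖p₃.1.1‖ + p₂.1.2) (a := p₁.1.2 / 2) (c := 2 * p₂.1.2)
      (half_pos p₁.2) ?_
    rintro x ⟨p, hp, h⟩
    have h' : sep p x < (1 / 4) ^ 2 := by simpa [r] using h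
    obtain ⟨a1, a2⟩ := abs_sub_lt_of_sep_lt (by norm_num) (by norm_num) h'
    have b1 : p₁.1.2 ≤ p.1.2 := h₁ hp
    have b2 : p.1.2 ≤ p₂.1.2 := h₂ hp
    have b3 : ‖p.1.1‖ ≤ ‖p₃.1.1‖ := h₃ hp
    have b4 := norm_sub_norm_le x.1.1 p.1.1
    rw [norm_sub_rev] at b4
    rw [abs_lt] at a2
    have := p.2
    refine ⟨?_, ?_, ?_⟩ <;> linarith
  have hint : ⋂ j, thickening (r j) K = K := by
    refine Subset.antisymm (fun x hx => ?_) (subset_iInter fun j => subset_thickening (hr0 j) K)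
    by_contra hxK
    obtain ⟨δ, hδ, hB⟩ := exists_sep_ball_subset (hK.isClosed.isOpen_compl.mem_nhds hxK)
    have hlim : Tendsto r atTop (𝓝 0) := by
      have := (tendsto_const_div_atTop_nhds_zero_nat (1 / 4 : ℝ)).comp (tendsto_add_atTop_nat 1)
      simpa [r, Function.comp_def] using this.pow 2
    obtain ⟨j, hj⟩ := (hlim.eventually (gt_mem_nhds hδ)).exists
    obtain ⟨p, hp, h⟩ := mem_iInter.1 hx j
    exact hB p (by rw [sep_comm]; exact h.trans hj) hp
  have hlim := tendsto_measure_iInter_atTop (μ := vol n) (s := fun j => thickening (r j) K)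
    (fun j => (isOpen_thickening _ K).measurableSet.nullMeasurableSet) hanti ⟨0, hfin.ne⟩
  rw [hint] at hlim
  obtain ⟨j, hj⟩ := (hlim.eventually (gt_mem_nhds hv)).exists
  exact ⟨r j, hr0 j, hj⟩

/-! ### Bodies with chambers -/

/-- A body `K` with chambers `Ch j`. The frame `F` is a connected part of `K` that stays away from
the complement of `K`; it walls in each chamber, except for a small `plug j`. The cores `Co j` are
connected, and stay away from the walls further than the size of a plug. All sizes are measured by
`sep`: `ρ` is the depth of the frame in `K`, `σ` the depth of a core in its chamber. -/
structure IsChambered {ι : Type*} (K F : Set (HypSpace n)) (Ch plug Co : ι → Set (HypSpace n))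
    (ρ σ : ℝ) : Prop where
  frame_deep : ∀ p ∈ F, ∀ q, sep p q < ρ → q ∈ interior K
  frame_conn : IsPreconnected F
  frontier_subset : ∀ j, frontier (Ch j) ⊆ F ∪ plug j
  /-- The hole of `K` in a plug is narrow compared to the depth of the frame. -/
  plug_near_body : ∀ j, ∀ p ∈ plug j, ∃ q ∈ interior K, sep p q < ρ
  /-- A plug is small compared to the depth of the core. -/
  plug_near_frame : ∀ j, ∀ p ∈ plug j, ∃ q ∈ F, sep p q < σ
  /-- The frame is too large to fit into a chamber. -/
  frame_large : ∃ p ∈ F, ∃ q ∈ F, ∀ j, ∀ p' ∈ Ch j, ∀ q' ∈ Ch j, sep p' q' < sep p q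
  core_conn : ∀ j, IsPreconnected (Co j)
  core_deep : ∀ j, ∀ p ∈ Co j, ∀ q, sep p q < σ → q ∈ Ch j
  depth_pos : 0 < ρ ∧ 0 < σ
  /-- From the core one can reach the frame on two ways that no single plug can block. -/
  two_ways : ∀ j, ∃ S₁ S₂ : Set (HypSpace n),
    (∀ S ∈ ({S₁, S₂} : Set (Set (HypSpace n))),
      IsPreconnected S ∧ S ⊆ Ch j ∪ F ∧ (S ∩ Co j).Nonempty ∧ (S ∩ F).Nonempty) ∧
    ∀ a₁ ∈ S₁, ∀ a₂ ∈ S₂, ∀ i, ∀ b₁ ∈ plug i, ∀ b₂ ∈ plug i, sep b₁ b₂ < sep a₁ a₂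

theorem disjoint_interior_closure {X : Type*} [TopologicalSpace X] {s t : Set X}
    (ht : IsOpen t) (hst : Disjoint s t) :
    Disjoint (interior (closure s)) (interior (closure t)) :=
  ((((hst.closure_left ht).mono_left interior_subset).closure_right isOpen_interior)).mono_right
    interior_subset

theorem _root_.IsPreconnected.inter_frontier_nonempty {X : Type*} [TopologicalSpace X]
    {s t : Set X} (hs : IsPreconnected s) (h : (s ∩ t).Nonempty) (h' : (s ∩ tᶜ).Nonempty) :
    (s ∩ frontier t).Nonempty := by
  by_contra hne
  have hd : ∀ x ∈ s, x ∉ frontier t := fun x hx hxf => hne ⟨x, hx, hxf⟩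
  have hcov : s ⊆ interior t ∪ interior tᶜ := fun x hx => by
    by_contra hx'
    rw [mem_union, not_or, interior_compl, notMem_compl_iff] at hx'
    exact hd x hx ⟨hx'.2, hx'.1⟩
  have h1 : (s ∩ interior t).Nonempty := by
    obtain ⟨x, hx, hxt⟩ := h
    refine ⟨x, hx, ?_⟩
    by_contra hi
    exact hd x hx ⟨subset_closure hxt, hi⟩
  have h2 : (s ∩ interior tᶜ).Nonempty := by
    obtain ⟨x, hx, hxt⟩ := h'
    refine ⟨x, hx, ?_⟩
    rw [interior_compl]
    exact fun hc => hd x hx ⟨hc, fun hi => hxt (interior_subset hi)⟩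
  obtain ⟨x, -, hx1, hx2⟩ := hs _ _ isOpen_interior isOpen_interior hcov h1 h2
  exact interior_subset hx2 (interior_subset hx1)

theorem isPreconnected_smul {S : Set (HypSpace n)} (hS : IsPreconnected S) (g : IsomGroup n) :
    IsPreconnected (g • S) :=
  hS.image _ g.1.continuous.continuousOn

theorem frontier_smul (g : IsomGroup n) (S : Set (HypSpace n)) :
    frontier (g • S) = g • frontier S :=
  (g.1.image_frontier S).symm

namespace IsChambered

variable {ι : Type*} {K F : Set (HypSpace n)} {Ch plug Co : ι → Set (HypSpace n)} {ρ σ : ℝ}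

/-- Congruent frames in disjoint bodies stay apart. -/
theorem frame_apart (H : IsChambered K F Ch plug Co ρ σ) {g h : IsomGroup n}
    (hgh : Disjoint (interior (g • K)) (interior (h • K))) {p q : HypSpace n} (hp : p ∈ g • F)
    (hq : q ∈ h • interior K) : ρ ≤ sep p q := by
  by_contra! hlt
  obtain ⟨p, hp, rfl⟩ := hp
  obtain ⟨q, hq, rfl⟩ := hq
  have hmem : h • q ∈ interior (g • K) := by
    rw [interior_smul, mem_smul_set_iff_inv_smul_mem]
    refine H.frame_deep p hp _ ?_
    rw [← sep_smul g, smul_inv_smul]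
    exact hlt
  have hmem' : h • q ∈ interior (h • K) := by
    rw [interior_smul]
    exact smul_mem_smul_set hq
  exact disjoint_left.1 hgh hmem hmem'

theorem frame_subset (H : IsChambered K F Ch plug Co ρ σ) : F ⊆ interior K := fun p hp =>
  H.frame_deep p hp p (by rw [sep_self]; exact H.depth_pos.1)

theorem core_subset (H : IsChambered K F Ch plug Co ρ σ) (j : ι) : Co j ⊆ Ch j := fun p hp =>
  H.core_deep j p hp p (by rw [sep_self]; exact H.depth_pos.2)

theorem disjoint_frame (H : IsChambered K F Ch plug Co ρ σ) {g h : IsomGroup n}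
    (hgh : Disjoint (interior (g • K)) (interior (h • K))) : Disjoint (g • F) (h • F) := by
  refine disjoint_left.2 fun p hp hp' => ?_
  have := H.frame_apart hgh hp (smul_set_mono H.frame_subset hp')
  rw [sep_self] at this
  exact absurd H.depth_pos.1 this.not_gt

/-- The frame of one body does not enter the chambers of the other: it is too thick to pass
through a plug, and too large to be inside. -/
theorem disjoint_frame_chamber (H : IsChambered K F Ch plug Co ρ σ) {g h : IsomGroup n}
    (hgh : Disjoint (interior (g • K)) (interior (h • K))) (j : ι) :
    Disjoint (g • F) (h • Ch j) := by
  by_contra hnd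
  have hne := not_disjoint_iff_nonempty_inter.1 hnd
  have hsub : g • F ⊆ h • Ch j := by
    by_contra hsub
    obtain ⟨p, hp, hp'⟩ := not_subset.1 hsub
    obtain ⟨q, hq, hq'⟩ :=
      (isPreconnected_smul H.frame_conn g).inter_frontier_nonempty hne ⟨p, hp, hp'⟩
    rw [frontier_smul] at hq'
    obtain ⟨q, hq', rfl⟩ := hq'
    rcases H.frontier_subset j hq' with hqF | hqP
    · exact disjoint_left.1 (H.disjoint_frame hgh) hq (smul_mem_smul_set hqF)
    · obtain ⟨b, hb, hlt⟩ := H.plug_near_body j q hqP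
      have := H.frame_apart hgh hq (smul_mem_smul_set hb)
      rw [sep_smul] at this
      exact absurd hlt this.not_gt
  obtain ⟨p, hp, q, hq, hlarge⟩ := H.frame_large
  obtain ⟨p', hp', e⟩ := hsub (smul_mem_smul_set hp)
  obtain ⟨q', hq', e'⟩ := hsub (smul_mem_smul_set hq)
  have := hlarge j p' hp' q' hq'
  rw [← sep_smul h, ← sep_smul g p] at this
  simp only at e e'
  rw [e, e'] at this
  exact lt_irrefl _ this

/-- A core of one body that meets a chamber of the other is contained in it. -/
theorem core_subset_chamber (H : IsChambered K F Ch plug Co ρ σ) {g h : IsomGroup n}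
    (hgh : Disjoint (interior (g • K)) (interior (h • K))) {i j : ι}
    (hne : (h • Co j ∩ g • Ch i).Nonempty) : h • Co j ⊆ g • Ch i := by
  by_contra hsub
  obtain ⟨p, hp, hp'⟩ := not_subset.1 hsub
  obtain ⟨q, hq, hq'⟩ :=
    (isPreconnected_smul (H.core_conn j) h).inter_frontier_nonempty hne ⟨p, hp, hp'⟩
  rw [frontier_smul] at hq'
  obtain ⟨a, ha, rfl⟩ := hq'
  have key : ∀ b ∈ F, sep a b < σ → False := by
    intro b hb hlt
    refine disjoint_left.1 (H.disjoint_frame_chamber hgh j) (smul_mem_smul_set hb) ?_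
    rw [mem_smul_set_iff_inv_smul_mem] at hq ⊢
    refine H.core_deep j _ hq _ ?_
    rw [sep_smul, sep_smul]
    exact hlt
  rcases H.frontier_subset i ha with haF | haP
  · exact key a haF (by rw [sep_self]; exact H.depth_pos.2)
  · obtain ⟨b, hb, hlt⟩ := H.plug_near_frame i a haP
    exact key b hb hlt

/-- Disjoint congruent copies of `K` have disjoint cores. If two cores met, each would lie in the
chamber of the other; the two ways out of the one core then have to leave the chamber of the other
body, and the only exit is a single plug. -/
theorem disjoint_core (H : IsChambered K F Ch plug Co ρ σ) {g h : IsomGroup n}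
    (hgh : Disjoint (interior (g • K)) (interior (h • K))) :
    Disjoint (g • ⋃ i, Co i) (h • ⋃ j, Co j) := by
  refine disjoint_left.2 fun p hp hp' => ?_
  obtain ⟨p₁, hp₁, rfl⟩ := hp
  obtain ⟨p₂, hp₂, e⟩ := hp'
  obtain ⟨i, hi⟩ := mem_iUnion.1 hp₁
  obtain ⟨j, hj⟩ := mem_iUnion.1 hp₂
  have hsub : h • Co j ⊆ g • Ch i := H.core_subset_chamber hgh
    ⟨h • p₂, smul_mem_smul_set hj, mem_smul_set.2 ⟨p₁, H.core_subset i hi, e.symm⟩⟩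
  obtain ⟨S₁, S₂, hS, hfar⟩ := H.two_ways j
  have exit : ∀ S ∈ ({S₁, S₂} : Set (Set (HypSpace n))), ∃ a ∈ S, ∃ b ∈ plug i,
      h • a = g • b := by
    intro S hSm
    obtain ⟨hconn, hSF, ⟨s, hs, hsC⟩, ⟨t, ht, htF⟩⟩ := hS S hSm
    have hin : (h • S ∩ g • Ch i).Nonempty :=
      ⟨h • s, smul_mem_smul_set hs, hsub (smul_mem_smul_set hsC)⟩
    have hout : (h • S ∩ (g • Ch i)ᶜ).Nonempty :=
      ⟨h • t, smul_mem_smul_set ht,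
        disjoint_left.1 (H.disjoint_frame_chamber hgh.symm i) (smul_mem_smul_set htF)⟩
    obtain ⟨_, ⟨a, ha, rfl⟩, hfr⟩ :=
      (isPreconnected_smul hconn h).inter_frontier_nonempty hin hout
    rw [frontier_smul] at hfr
    obtain ⟨b, hb, hba⟩ := hfr
    rcases H.frontier_subset i hb with hbF | hbP
    · exfalso
      have hbF' : h • a ∈ g • F := by
        rw [← show g • b = h • a from hba]
        exact smul_mem_smul_set hbF
      rcases hSF ha with haC | haF
      · exact disjoint_left.1 (H.disjoint_frame_chamber hgh j) hbF' (smul_mem_smul_set haC)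
      · exact disjoint_left.1 (H.disjoint_frame hgh) hbF' (smul_mem_smul_set haF)
    · exact ⟨a, ha, b, hbP, hba.symm⟩
  obtain ⟨a₁, ha₁, b₁, hb₁, e₁⟩ := exit S₁ (by simp)
  obtain ⟨a₂, ha₂, b₂, hb₂, e₂⟩ := exit S₂ (by simp)
  have := hfar a₁ ha₁ a₂ ha₂ i b₁ hb₁ b₂ hb₂
  rw [← sep_smul h a₁, e₁, e₂, sep_smul] at this
  exact lt_irrefl _ this

end IsChambered

/-! ### Boxes and frames -/

/-- The points `(x, t)` with `s xᵢ - wᵢ ∈ X` for all `i` and `t ∈ T`. -/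
def box (s : ℝ) (w : Fin (n - 1) → ℝ) (X T : Set ℝ) : Set (HypSpace n) :=
  {p | (∀ i, s * p.1.1 i - w i ∈ X) ∧ p.1.2 ∈ T}

theorem box_mono {s : ℝ} {w : Fin (n - 1) → ℝ} {X X' T T' : Set ℝ} (hX : X ⊆ X') (hT : T ⊆ T') :
    box s w X T ⊆ box s w X' T' := fun _ hp => ⟨fun i => hX (hp.1 i), hT hp.2⟩

theorem box_eq (s : ℝ) (w : Fin (n - 1) → ℝ) (X T : Set ℝ) :
    box s w X T = (⋂ i, (fun p : HypSpace n => s * p.1.1 i - w i) ⁻¹' X) ∩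
      (fun p : HypSpace n => p.1.2) ⁻¹' T := by
  ext p
  simp [box]

theorem isOpen_box {s : ℝ} {w : Fin (n - 1) → ℝ} {X T : Set ℝ} (hX : IsOpen X) (hT : IsOpen T) :
    IsOpen (box s w X T : Set (HypSpace n)) := by
  rw [box_eq]
  exact (isOpen_iInter_of_finite fun i => hX.preimage (by fun_prop)).inter
    (hT.preimage (by fun_prop))

theorem isClosed_box {s : ℝ} {w : Fin (n - 1) → ℝ} {X T : Set ℝ} (hX : IsClosed X)
    (hT : IsClosed T) : IsClosed (box s w X T : Set (HypSpace n)) := by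
  rw [box_eq]
  exact (isClosed_iInter fun i => hX.preimage (by fun_prop)).inter (hT.preimage (by fun_prop))

theorem isCompact_box {s : ℝ} (hs : 0 < s) {w : Fin (n - 1) → ℝ} {l u a c : ℝ} (ha : 0 < a) :
    IsCompact (box s w (Icc l u) (Icc a c) : Set (HypSpace n)) := by
  rw [Subtype.isCompact_iff]
  have h1 : IsCompact {x : EuclideanSpace ℝ (Fin (n - 1)) |
      ∀ i, x i ∈ Icc ((l + w i) / s) ((u + w i) / s)} := by
    have h := (EuclideanSpace.equiv (Fin (n - 1)) ℝ).toHomeomorph.isCompact_preimage.2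
      (isCompact_univ_pi fun i => (isCompact_Icc : IsCompact (Icc ((l + w i) / s) ((u + w i) / s))))
    convert h using 1
    ext x
    exact mem_univ_pi.symm
  convert h1.prod (isCompact_Icc : IsCompact (Icc a c)) using 1
  ext v
  constructor
  · rintro ⟨p, ⟨hp, hp'⟩, rfl⟩
    refine ⟨fun i => ?_, hp'⟩
    have := hp i
    rw [mem_Icc] at this ⊢
    rw [div_le_iff₀ hs, le_div_iff₀ hs]
    constructor <;> linarith
  · rintro ⟨hv, hv'⟩
    refine ⟨⟨v, ha.trans_le hv'.1⟩, ⟨fun i => ?_, hv'⟩, rfl⟩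
    have := hv i
    rw [mem_Icc, div_le_iff₀ hs, le_div_iff₀ hs] at this
    rw [mem_Icc]
    constructor <;> linarith

theorem isPreconnected_of_convex {S : Set (HypSpace n)} (h : Convex ℝ (Subtype.val '' S)) :
    IsPreconnected S :=
  Topology.IsInducing.subtypeVal.isPreconnected_image.1 h.isPreconnected

theorem isPreconnected_box {s : ℝ} {w : Fin (n - 1) → ℝ} {X T : Set ℝ} (hX : Convex ℝ X)
    (hT : Convex ℝ T) : IsPreconnected (box s w X T : Set (HypSpace n)) := by
  refine isPreconnected_of_convex ?_
  rintro _ ⟨p, ⟨hp, hp'⟩, rfl⟩ _ ⟨q, ⟨hq, hq'⟩, rfl⟩ a b ha hb hab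
  have hpos : 0 < (a • p.1 + b • q.1).2 :=
    convex_Ioi (0 : ℝ) p.2 q.2 ha hb hab
  refine ⟨⟨_, hpos⟩, ⟨fun i => ?_, hT hp' hq' ha hb hab⟩, rfl⟩
  have h := hX (hp i) (hq i) ha hb hab
  convert h using 1
  simp only [Prod.fst_add, Prod.smul_fst, PiLp.add_apply, PiLp.smul_apply, smul_eq_mul]
  linear_combination (w i) * hab

theorem box_Icc_subset_closure {s : ℝ} (hs : 0 < s) {w : Fin (n - 1) → ℝ} {l u a c : ℝ}
    (hlu : l < u) (ha : 0 ≤ a) (hac : a < c) :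
    (box s w (Icc l u) (Icc a c) : Set (HypSpace n)) ⊆
      closure (box s w (Ioo l u) (Ioo a c)) := by
  rintro p ⟨hp, hp'⟩
  rw [closure_subtype]
  -- move `p` towards the centre of the box
  set q : Coord n := (WithLp.toLp 2 fun i => ((l + u) / 2 + w i) / s, (a + c) / 2) with hq
  have hlim : Tendsto (fun ε : ℝ => (1 - ε) • p.1 + ε • q) (𝓝[>] 0) (𝓝 p.1) := by
    have hcont : Continuous fun ε : ℝ => (1 - ε) • p.1 + ε • q := by fun_prop
    have := (hcont.tendsto 0).mono_left (nhdsWithin_le_nhds (s := Ioi 0))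
    simpa using this
  refine mem_closure_of_tendsto hlim ?_
  filter_upwards [Ioo_mem_nhdsGT (zero_lt_one' ℝ)] with ε hε
  obtain ⟨h0, h1⟩ := hε
  have ht : ((1 - ε) • p.1 + ε • q).2 ∈ Ioo a c := by
    have := hp'.1
    have := hp'.2
    simp only [Prod.snd_add, Prod.smul_snd, smul_eq_mul, hq]
    constructor <;> nlinarith
  refine ⟨⟨_, ha.trans_lt ht.1⟩, ⟨fun i => ?_, ht⟩, rfl⟩
  have := (hp i).1
  have := (hp i).2
  have e : s * ((1 - ε) • p.1 + ε • q).1 i - w i =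
      (1 - ε) * (s * p.1.1 i - w i) + ε * ((l + u) / 2) := by
    simp only [Prod.fst_add, Prod.smul_fst, PiLp.add_apply, PiLp.smul_apply, smul_eq_mul, hq]
    field_simp
    ring
  rw [e]
  constructor <;> nlinarith

/-- The Euclidean segment between two points. -/
def hseg (p q : HypSpace n) : Set (HypSpace n) := Subtype.val ⁻¹' segment ℝ p.1 q.1

theorem isPreconnected_hseg (p q : HypSpace n) : IsPreconnected (hseg p q) := by
  refine isPreconnected_of_convex ?_
  have : Subtype.val '' hseg p q = segment ℝ p.1 q.1 := by
    refine image_preimage_eq_of_subset ?_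
    rintro _ ⟨a, b, ha, hb, hab, rfl⟩
    exact ⟨⟨a • p.1 + b • q.1, convex_Ioi (0 : ℝ) p.2 q.2 ha hb hab⟩, rfl⟩
  rw [this]
  exact convex_segment _ _

theorem left_mem_hseg (p q : HypSpace n) : p ∈ hseg p q := left_mem_segment ℝ _ _

theorem right_mem_hseg (p q : HypSpace n) : q ∈ hseg p q := right_mem_segment ℝ _ _

theorem fst_mem_of_mem_hseg {p q r : HypSpace n} (hr : r ∈ hseg p q) (i : Fin (n - 1)) :
    r.1.1 i ∈ segment ℝ (p.1.1 i) (q.1.1 i) := by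
  obtain ⟨a, b, ha, hb, hab, e⟩ := hr
  exact ⟨a, b, ha, hb, hab, by rw [← e]; simp⟩

theorem snd_mem_of_mem_hseg {p q r : HypSpace n} (hr : r ∈ hseg p q) :
    r.1.2 ∈ segment ℝ p.1.2 q.1.2 := by
  obtain ⟨a, b, ha, hb, hab, e⟩ := hr
  exact ⟨a, b, ha, hb, hab, by rw [← e]; simp⟩

/-- The number `v i` as a real number, for `v : Fin (n - 1) → Fin b`; these are the positions of
the subcubes of side `1 / b` of the unit cube. -/
def cell {b : ℕ} (v : Fin (n - 1) → Fin b) (i : Fin (n - 1)) : ℝ := ((v i : ℕ) : ℝ)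

theorem cell_eq_of_mem {b : ℕ} {v v' : Fin (n - 1) → Fin b} {i : Fin (n - 1)} {y : ℝ}
    (h : y - cell v i ∈ Ioo (0 : ℝ) 1) (h' : y - cell v' i ∈ Ioo (0 : ℝ) 1) : v i = v' i := by
  unfold cell at h h'
  have h1 : ((v i : ℕ) : ℝ) < (v' i : ℕ) + 1 := by linarith [h.1, h'.2]
  have h2 : ((v' i : ℕ) : ℝ) < (v i : ℕ) + 1 := by linarith [h'.1, h.2]
  norm_cast at h1 h2
  omega

/-- A box over the unit cube from which, in the columns over the subcubes of side `1 / b`, the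
boxes with horizontal extent `Y` and height range `T₁` (rooms) and those with horizontal extent `Z`
and height range `T₂` (corridors) are removed. -/
def frame (n b : ℕ) (X T Y T₁ Z T₂ : Set ℝ) : Set (HypSpace n) :=
  {p | p ∈ box 1 0 X T ∧ ∀ v : Fin (n - 1) → Fin b, p ∉ box b (cell v) Y T₁ ∧
    p ∉ box b (cell v) Z T₂}

/-- A frame is connected: from each point there is a vertical way to the ceiling above all rooms,
except below a room, where one first has to move away from the corridor to the side of the room. -/
theorem isPreconnected_frame {b : ℕ} (hb : 0 < b) {X T Y T₁ Z T₂ : Set ℝ} (hX : Convex ℝ X)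
    (hT : Convex ℝ T) (hY : Y ⊆ Ioo 0 1) (hZY : Z ⊆ Y) (hZ : Z.OrdConnected)
    (hT₁ : T₁.OrdConnected)
    {ylo yhi top : ℝ} (hlo : ylo ∈ Ioo (0 : ℝ) 1) (hhi : yhi ∈ Ioo (0 : ℝ) 1)
    (hloY : ∀ y ∈ Y, ylo < y) (hhiY : ∀ y ∈ Y, y < yhi)
    (hloX : ∀ k : Fin b, (((k : ℕ) : ℝ) + ylo) / b ∈ X)
    (hhiX : ∀ k : Fin b, (((k : ℕ) : ℝ) + yhi) / b ∈ X)
    (htop : top ∈ T) (htop₁ : ∀ t ∈ T₁, t < top) (hT₂ : ∀ t ∈ T₂, ∃ t' ∈ T₁, t ≤ t')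
    (hbelow : ∀ t ∈ T, (∀ t' ∈ T₁, t < t') → t ∈ T₂) (htop0 : 0 < top) :
    IsPreconnected (frame n b X T Y T₁ Z T₂) := by
  have hb0 : (0 : ℝ) < b := by exact_mod_cast hb
  have htop₂ : ∀ t ∈ T₂, t < top := fun t ht => by
    obtain ⟨t', ht', h⟩ := hT₂ t ht
    exact h.trans_lt (htop₁ t' ht')
  set S : Set (HypSpace n) := box 1 0 X {top} with hS
  have hSconn : IsPreconnected S := isPreconnected_box hX (convex_singleton top)
  have hSsub : S ⊆ frame n b X T Y T₁ Z T₂ := by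
    rintro p ⟨hp, hp'⟩
    have hp' : p.1.2 = top := hp'
    refine ⟨⟨hp, hp' ▸ htop⟩, fun v => ⟨fun h => ?_, fun h => ?_⟩⟩
    · exact (htop₁ _ h.2).ne hp'
    · exact (htop₂ _ h.2).ne hp'
  -- vertical ways
  have vert : ∀ p ∈ frame n b X T Y T₁ Z T₂,
      ((∀ v : Fin (n - 1) → Fin b, ¬ ∀ i, b * p.1.1 i - cell v i ∈ Y) ∨ ∀ t ∈ T₁, t < p.1.2) →
      ∃ V ⊆ frame n b X T Y T₁ Z T₂, IsPreconnected V ∧ p ∈ V ∧ (V ∩ S).Nonempty := by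
    intro p hp hw
    set q : HypSpace n := ⟨(p.1.1, top), htop0⟩
    refine ⟨hseg p q, fun r hr => ?_, isPreconnected_hseg p q, left_mem_hseg p q, q,
      right_mem_hseg p q, hp.1.1, rfl⟩
    have h1 : ∀ i, r.1.1 i = p.1.1 i := fun i => by
      have := fst_mem_of_mem_hseg hr i
      rwa [segment_same] at this
    have h2 := snd_mem_of_mem_hseg hr
    refine ⟨⟨fun i => ?_, hT.segment_subset hp.1.2 htop h2⟩, fun v => ?_⟩
    · rw [h1]
      exact hp.1.1 i
    · rcases hw with hw | hw
      · refine ⟨fun h => hw v fun i => ?_, fun h => hw v fun i => ?_⟩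
        · rw [← h1]
          exact h.1 i
        · rw [← h1]
          exact hZY (h.1 i)
      · have h3 : ∀ t ∈ T₁, t < r.1.2 := fun t ht =>
          (convex_Ioi t).segment_subset (hw t ht) (htop₁ t ht) h2
        refine ⟨fun h => (h3 _ h.2).ne rfl, fun h => ?_⟩
        obtain ⟨t', ht', hle⟩ := hT₂ _ h.2
        exact (h3 t' ht').not_ge hle
  set p₀ : HypSpace n := ⟨(WithLp.toLp 2 fun _ => (((⟨0, hb⟩ : Fin b) : ℕ) + ylo) / b, top), htop0⟩
  have hp₀ : p₀ ∈ S := ⟨fun i => by simpa [p₀] using hloX ⟨0, hb⟩, rfl⟩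
  refine isPreconnected_of_forall p₀ fun p hp => ?_
  by_cases hw : (∀ v : Fin (n - 1) → Fin b, ¬ ∀ i, b * p.1.1 i - cell v i ∈ Y) ∨
      ∀ t ∈ T₁, t < p.1.2
  · obtain ⟨V, hV, hVc, hpV, q, hqV, hqS⟩ := vert p hp hw
    exact ⟨V ∪ S, union_subset hV hSsub, Or.inr hp₀, Or.inl hpV, hVc.union q hqV hqS hSconn⟩
  · push Not at hw
    obtain ⟨⟨v, hv⟩, t₁, ht₁, hle⟩ := hw
    have hpT₁ : p.1.2 ∉ T₁ := fun h => (hp.2 v).1 ⟨hv, h⟩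
    -- `p` is below a room
    have hlow : ∀ t ∈ T₁, p.1.2 < t := fun t ht => by
      by_contra! h
      exact hpT₁ (hT₁.out ht ht₁ ⟨h, hle⟩)
    have hpT₂ := hbelow _ hp.1.2 hlow
    obtain ⟨i, hi⟩ : ∃ i, b * p.1.1 i - cell v i ∉ Z := by
      by_contra! h
      exact (hp.2 v).2 ⟨h, hpT₂⟩
    -- the end of the way to the side, and the fact that the way avoids the corridor
    obtain ⟨y, hy01, hyX, hyY, hyZ⟩ : ∃ y ∈ Ioo (0 : ℝ) 1,
        (((v i : ℕ) : ℝ) + y) / b ∈ X ∧ y ∉ Y ∧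
        ∀ z ∈ segment ℝ (b * p.1.1 i - cell v i) y, z ∉ Z := by
      by_cases hz : ∀ z ∈ Z, z < b * p.1.1 i - cell v i
      · refine ⟨yhi, hhi, hhiX _, fun h => (hhiY _ h).ne rfl, fun z hzs hzZ => ?_⟩
        rw [segment_eq_Icc (hhiY _ (hv i)).le] at hzs
        exact (hz z hzZ).not_ge hzs.1
      · push Not at hz
        obtain ⟨z₀, hz₀, hle₀⟩ := hz
        refine ⟨ylo, hlo, hloX _, fun h => (hloY _ h).ne rfl, fun z hzs hzZ => ?_⟩
        rw [segment_symm, segment_eq_Icc (hloY _ (hv i)).le] at hzs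
        exact hi (hZ.out hzZ hz₀ ⟨hzs.2, hle₀⟩)
    set q : HypSpace n := ⟨(WithLp.toLp 2 (Function.update p.1.1 i (((v i : ℕ) + y) / b)), p.1.2),
      p.2⟩ with hq
    have hqi : q.1.1 i = ((v i : ℕ) + y) / b := by simp [hq]
    have hqj : ∀ j ≠ i, q.1.1 j = p.1.1 j := fun j hj => by simp [hq, hj]
    have hqy : b * q.1.1 i - cell v i = y := by
      rw [hqi]
      unfold cell
      field_simp
      ring
    have hqX : ∀ j, 1 * q.1.1 j - (0 : Fin (n - 1) → ℝ) j ∈ X := by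
      intro j
      by_cases hj : j = i
      · subst hj
        rw [hqi]
        simpa using hyX
      · rw [hqj j hj]
        exact hp.1.1 j
    have hway : hseg p q ⊆ frame n b X T Y T₁ Z T₂ := by
      intro r hr
      have h2 : r.1.2 = p.1.2 := by
        have := snd_mem_of_mem_hseg hr
        rwa [segment_same] at this
      have hri := fst_mem_of_mem_hseg hr i
      have hri' : b * r.1.1 i - cell v i ∈ segment ℝ (b * p.1.1 i - cell v i) y := by
        obtain ⟨c, d, hc, hd, hcd, e⟩ := hri
        refine ⟨c, d, hc, hd, hcd, ?_⟩
        rw [← e, ← hqy]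
        simp only [smul_eq_mul]
        linear_combination (-cell v i) * hcd
      refine ⟨⟨fun j => ?_, h2 ▸ hp.1.2⟩, fun v' => ⟨fun h => hpT₁ (h2 ▸ h.2), fun h => ?_⟩⟩
      · have h3 := hp.1.1 j
        have h4 := hqX j
        simp only [one_mul, Pi.zero_apply, sub_zero] at h3 h4 ⊢
        exact hX.segment_subset h3 h4 (fst_mem_of_mem_hseg hr j)
      · have h3 := (convex_Ioo (0 : ℝ) 1).segment_subset (hY (hv i)) hy01 hri'
        have h4 := cell_eq_of_mem h3 (hY (hZY (h.1 i)))
        refine hyZ _ hri' ?_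
        have h5 := h.1 i
        unfold cell at h5 ⊢
        rwa [h4]
    have hqw : ∀ v' : Fin (n - 1) → Fin b, ¬ ∀ j, b * q.1.1 j - cell v' j ∈ Y := by
      intro v' h
      have h3 : b * q.1.1 i - cell v i ∈ Ioo (0 : ℝ) 1 := hqy ▸ hy01
      have h4 := cell_eq_of_mem h3 (hY (h i))
      refine hyY ?_
      rw [← hqy]
      have h5 := h i
      unfold cell at h5 ⊢
      rwa [h4]
    obtain ⟨V, hV, hVc, hqV, q', hqV', hqS⟩ := vert q (hway (right_mem_hseg p q)) (Or.inl hqw)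
    exact ⟨hseg p q ∪ (V ∪ S), union_subset hway (union_subset hV hSsub), Or.inr (Or.inr hp₀),
      Or.inl (left_mem_hseg p q), (isPreconnected_hseg p q).union q (right_mem_hseg p q)
        (Or.inl hqV) (hVc.union q' hqV' hqS hSconn)⟩

/-! ### The tile and its tiling -/

/-- The half-width of the opening of a corridor in a chamber wall that is left by the frame, in
units of the side of a subcube. -/
def plugWidth (b : ℕ) (α : ℝ) : ℝ := α / (8 * b)

/-- The half-width of a corridor, in units of the side of a subcube. -/
def rodWidth (b : ℕ) (α : ℝ) : ℝ := plugWidth b α / (16 * b)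

/-- The part of the tile inside the box `[0, 1]ⁿ⁻¹ × [1, b]`: from each of the `bⁿ⁻¹` columns over
the subcubes of side `1 / b` a room is removed, leaving walls of relative thickness `α`, as well as
a thin corridor that leads from the bottom of the column to the room. -/
def tileFrame (n b : ℕ) (α : ℝ) : Set (HypSpace n) :=
  frame n b (Ioo 0 1) (Ioo 1 b) (Icc α (1 - α)) (Icc (1 + α) (b - α))
    (Icc (1 / 2 - rodWidth b α) (1 / 2 + rodWidth b α)) (Icc 1 (1 + α))

/-- The protrusion of the tile, which stands on top of the box. It is congruent to the union of a
corridor and a room. The parameter is `Ioo` or `Icc`, for the open and the closed version. -/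
def protrusion (n b : ℕ) (α : ℝ) (I : ℝ → ℝ → Set ℝ) : Set (HypSpace n) :=
  box 1 0 (I α (1 - α)) (I (b * (1 + α)) (b * (b - α))) ∪
    box 1 0 (I (1 / 2 - rodWidth b α) (1 / 2 + rodWidth b α)) (I b (b * (1 + α)))

/-- The tile: a frame with many rooms, and a single protrusion that fits into a room. -/
def tile (n b : ℕ) (α : ℝ) : Set (HypSpace n) :=
  closure (tileFrame n b α) ∪ protrusion n b α Icc

theorem shift_eq {w w' : ℤ} {x x' : ℝ} (hx : x ∈ Ioo (0 : ℝ) 1) (hx' : x' ∈ Ioo (0 : ℝ) 1)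
    (e : x + w = x' + w') : w = w' := by
  have h1 : (w : ℝ) < w' + 1 := by linarith [hx.1, hx'.2]
  have h2 : (w' : ℝ) < w + 1 := by linarith [hx'.1, hx.2]
  norm_cast at h1 h2
  omega

/-- The standing assumptions on the parameters. -/
structure Admissible (n b : ℕ) (α : ℝ) : Prop where
  two_le : 2 ≤ n
  four_le : 4 ≤ b
  pos : 0 < α
  le : α ≤ 1 / 16

namespace Admissible

variable {b : ℕ} {α : ℝ}

theorem four_le' (h : Admissible n b α) : (4 : ℝ) ≤ b := by exact_mod_cast h.four_le

theorem plugWidth_pos (h : Admissible n b α) : 0 < plugWidth b α := by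
  have := h.pos
  have := h.four_le'
  unfold plugWidth
  positivity

theorem plugWidth_mul (h : Admissible n b α) : plugWidth b α * (8 * b) = α := by
  have := h.four_le'
  unfold plugWidth
  field_simp

theorem plugWidth_le (h : Admissible n b α) : plugWidth b α ≤ α / 32 := by
  nlinarith [h.plugWidth_pos, h.plugWidth_mul, h.four_le']

theorem rodWidth_pos (h : Admissible n b α) : 0 < rodWidth b α := by
  have := h.plugWidth_pos
  have := h.four_le'
  unfold rodWidth
  positivity

theorem rodWidth_mul (h : Admissible n b α) : rodWidth b α * (16 * b) = plugWidth b α := by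
  have := h.four_le'
  unfold rodWidth
  field_simp

theorem rodWidth_le (h : Admissible n b α) : rodWidth b α ≤ plugWidth b α / 64 := by
  nlinarith [h.rodWidth_pos, h.rodWidth_mul, h.four_le']

/-- The first horizontal coordinate. -/
def index (h : Admissible n b α) : Fin (n - 1) := ⟨0, by have := h.two_le; omega⟩

theorem isPreconnected_tileFrame (h : Admissible n b α) : IsPreconnected (tileFrame n b α) := by
  have hb := h.four_le'
  have h0 := h.pos
  have h1 := h.le
  have h2 := h.plugWidth_le
  have h3 := h.rodWidth_pos
  have h4 := h.rodWidth_le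
  have hk : ∀ k : Fin b, ((k : ℕ) : ℝ) + 1 ≤ b := fun k => by exact_mod_cast k.2
  refine isPreconnected_frame (ylo := α / 2) (yhi := 1 - α / 2) (top := b - α / 2)
    (by have := h.four_le; omega) (convex_Ioo _ _) (convex_Ioo _ _) ?_ ?_ ordConnected_Icc
    ordConnected_Icc ?_ ?_ ?_ ?_ ?_ ?_ ?_ ?_ ?_ ?_ ?_
  · exact Icc_subset_Ioo h0 (by linarith)
  · exact Icc_subset_Icc (by linarith) (by linarith)
  · constructor <;> linarith
  · constructor <;> linarith
  · intro y hy
    linarith [hy.1]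
  · intro y hy
    linarith [hy.2]
  · intro k
    have := hk k
    refine ⟨by positivity, ?_⟩
    rw [div_lt_one (by linarith)]
    linarith
  · intro k
    have := hk k
    refine ⟨div_pos ?_ (by linarith), ?_⟩
    · have : (0 : ℝ) ≤ (k : ℕ) := by positivity
      linarith
    · rw [div_lt_one (by linarith)]
      linarith
  · constructor <;> linarith
  · intro t ht
    linarith [ht.2]
  · intro t ht
    exact ⟨1 + α, ⟨le_rfl, by linarith⟩, ht.2⟩
  · intro t ht hlow
    exact ⟨ht.1.le, (hlow (1 + α) ⟨le_rfl, by linarith⟩).le⟩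
  · linarith

theorem isOpen_removed (n b : ℕ) (α : ℝ) : IsOpen {p : HypSpace n | ∀ v : Fin (n - 1) → Fin b,
    p ∉ box b (cell v) (Icc α (1 - α)) (Icc (1 + α) (b - α)) ∧
    p ∉ box b (cell v) (Icc (1 / 2 - rodWidth b α) (1 / 2 + rodWidth b α)) (Icc 1 (1 + α))} := by
  rw [ofPred_forall]
  exact isOpen_iInter_of_finite fun v =>
    (isClosed_box isClosed_Icc isClosed_Icc).isOpen_compl.inter
      (isClosed_box isClosed_Icc isClosed_Icc).isOpen_compl

theorem isOpen_tileFrame (n b : ℕ) (α : ℝ) : IsOpen (tileFrame n b α) :=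
  (isOpen_box isOpen_Ioo isOpen_Ioo).inter (isOpen_removed n b α)

theorem mem_closure_tileFrame (h : Admissible n b α) {p : HypSpace n}
    (hp : p ∈ box 1 0 (Icc 0 1) (Icc 1 (b : ℝ)))
    (hv : ∀ v : Fin (n - 1) → Fin b, p ∉ box b (cell v) (Icc α (1 - α)) (Icc (1 + α) (b - α)) ∧
      p ∉ box b (cell v) (Icc (1 / 2 - rodWidth b α) (1 / 2 + rodWidth b α)) (Icc 1 (1 + α))) :
    p ∈ closure (tileFrame n b α) := by
  have hb := h.four_le'
  have := (isOpen_removed n b α).inter_closure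
    ⟨hv, box_Icc_subset_closure one_pos one_pos zero_le_one (by linarith) hp⟩
  rwa [inter_comm] at this

theorem isOpen_protrusion (n b : ℕ) (α : ℝ) : IsOpen (protrusion n b α Ioo) :=
  (isOpen_box isOpen_Ioo isOpen_Ioo).union (isOpen_box isOpen_Ioo isOpen_Ioo)

theorem protrusion_Icc_subset (h : Admissible n b α) :
    protrusion n b α Icc ⊆ closure (protrusion n b α Ioo) := by
  have hb := h.four_le'
  have h0 := h.pos
  have h1 := h.le
  have h3 := h.rodWidth_pos
  rw [protrusion, protrusion, closure_union]
  refine union_subset_union (box_Icc_subset_closure one_pos ?_ ?_ ?_)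
    (box_Icc_subset_closure one_pos ?_ ?_ ?_)
  · linarith
  · positivity
  · nlinarith
  · linarith
  · positivity
  · nlinarith

theorem isCompact_protrusion (h : Admissible n b α) : IsCompact (protrusion n b α Icc) := by
  have hb := h.four_le'
  have h0 := h.pos
  exact (isCompact_box one_pos (by positivity)).union (isCompact_box one_pos (by positivity))

/-- The tile is the closure of an open set. -/
theorem tile_eq_closure (h : Admissible n b α) :
    tile n b α = closure (tileFrame n b α ∪ protrusion n b α Ioo) := by
  rw [closure_union]
  refine Subset.antisymm (union_subset_union_right _ h.protrusion_Icc_subset)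
    (union_subset_union_right _ (closure_minimal ?_ h.isCompact_protrusion.isClosed))
  exact union_subset_union (box_mono Ioo_subset_Icc_self Ioo_subset_Icc_self)
    (box_mono Ioo_subset_Icc_self Ioo_subset_Icc_self)

theorem tileFrame_subset_interior (n b : ℕ) (α : ℝ) :
    tileFrame n b α ⊆ interior (tile n b α) :=
  interior_maximal (subset_closure.trans subset_union_left) (isOpen_tileFrame n b α)

theorem isBody_tile (h : Admissible n b α) : IsBody (tile n b α) := by
  have hb := h.four_le'
  have h0 := h.pos
  have h1 := h.le
  have h2 := h.plugWidth_le
  have h3 := h.rodWidth_pos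
  have h4 := h.rodWidth_le
  -- a point common to the frame and the protrusion, and one common to the parts of the latter
  set p : HypSpace n := ⟨(WithLp.toLp 2 fun _ => 1 / 2, b), by
    change (0 : ℝ) < b
    linarith⟩ with hp
  set q : HypSpace n := ⟨(WithLp.toLp 2 fun _ => 1 / 2, b * (1 + α)), by simp; positivity⟩ with hq
  have hpi : ∀ i, p.1.1 i = 1 / 2 := fun i => rfl
  have hqi : ∀ i, q.1.1 i = 1 / 2 := fun i => rfl
  have hpP : p ∈ protrusion n b α Icc := by
    refine Or.inr ⟨fun i => ?_, le_rfl, ?_⟩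
    · rw [hpi]
      constructor <;> simp <;> linarith
    · change (b : ℝ) ≤ b * (1 + α)
      nlinarith
  have hpF : p ∈ closure (tileFrame n b α) := by
    refine h.mem_closure_tileFrame ⟨fun i => ?_, ?_⟩ fun v => ⟨fun hv => ?_, fun hv => ?_⟩
    · rw [hpi]
      constructor <;> norm_num
    · exact ⟨by linarith, le_rfl⟩
    · have : (b : ℝ) ≤ b - α := hv.2.2
      linarith
    · have : (b : ℝ) ≤ 1 + α := hv.2.2
      linarith
  refine ⟨⟨⟨p, Or.inl hpF⟩, ?_⟩, ?_, ?_⟩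
  · refine h.isPreconnected_tileFrame.closure.union p hpF hpP ?_
    refine (isPreconnected_box (convex_Icc _ _) (convex_Icc _ _)).union q ⟨fun i => ?_, ?_⟩
      ⟨fun i => ?_, ?_⟩ (isPreconnected_box (convex_Icc _ _) (convex_Icc _ _))
    · rw [hqi]
      constructor <;> simp <;> linarith
    · refine ⟨le_rfl, ?_⟩
      change (b : ℝ) * (1 + α) ≤ b * (b - α)
      nlinarith
    · rw [hqi]
      constructor <;> simp <;> linarith
    · refine ⟨?_, le_rfl⟩
      change (b : ℝ) ≤ b * (1 + α)
      nlinarith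
  · refine IsCompact.union ?_ h.isCompact_protrusion
    refine (isCompact_box one_pos one_pos : IsCompact (box 1 0 (Icc 0 1)
      (Icc 1 (b : ℝ)) : Set (HypSpace n))).of_isClosed_subset isClosed_closure ?_
    refine closure_minimal (fun x hx => ?_) (isClosed_box isClosed_Icc isClosed_Icc)
    exact box_mono Ioo_subset_Icc_self Ioo_subset_Icc_self hx.1
  · rw [h.tile_eq_closure]
    refine Subset.antisymm (closure_minimal interior_subset isClosed_closure) (closure_mono ?_)
    exact interior_maximal subset_closure
      ((isOpen_tileFrame n b α).union (isOpen_protrusion n b α))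

/-- The isometry `(x, t) ↦ (bᵏ (x + w), bᵏ t)` that maps the tile to a member of the tiling. -/
def tileMap (h : Admissible n b α) (k : ℤ) (w : Fin (n - 1) → ℤ) : IsomGroup n :=
  aff ((b : ℝ) ^ k) (zpow_pos (by have := h.four_le'; linarith) k)
    (WithLp.toLp 2 fun i => (w i : ℝ))

theorem tileMap_fst (h : Admissible n b α) (k : ℤ) (w : Fin (n - 1) → ℤ) (p : HypSpace n)
    (i : Fin (n - 1)) : (h.tileMap k w • p).1.1 i = (b : ℝ) ^ k * (p.1.1 i + w i) := rfl

theorem tileMap_snd (h : Admissible n b α) (k : ℤ) (w : Fin (n - 1) → ℤ) (p : HypSpace n) :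
    (h.tileMap k w • p).1.2 = (b : ℝ) ^ k * p.1.2 := rfl

theorem level_eq (h : Admissible n b α) {k k' : ℤ} {t t' : ℝ} (ht : t ∈ Ioo (1 : ℝ) b)
    (ht' : t' ∈ Ioo (1 : ℝ) b) (e : (b : ℝ) ^ k * t = (b : ℝ) ^ k' * t') : k = k' := by
  have hb := h.four_le'
  have hb0 : (b : ℝ) ≠ 0 := by linarith
  have key : ∀ {k k' : ℤ} {t t' : ℝ}, t ∈ Ioo (1 : ℝ) b → t' ∈ Ioo (1 : ℝ) b →
      (b : ℝ) ^ k * t = (b : ℝ) ^ k' * t' → k < k' + 1 := by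
    intro k k' t t' ht ht' e
    have hk : 0 < (b : ℝ) ^ k := zpow_pos (by linarith) k
    have hk' : 0 < (b : ℝ) ^ k' := zpow_pos (by linarith) k'
    rw [← zpow_lt_zpow_iff_right₀ (by linarith : (1 : ℝ) < b), zpow_add_one₀ hb0]
    nlinarith [ht.1, ht'.2]
  have h1 := key ht ht' e
  have h2 := key ht' ht e.symm
  omega

theorem protrusion_subset (h : Admissible n b α) :
    protrusion n b α Ioo ⊆ box 1 0 (Ioo 0 1) (Ioo (b : ℝ) (b * b)) := by
  have hb := h.four_le'
  have h0 := h.pos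
  have h1 := h.le
  have h2 := h.plugWidth_le
  have h3 := h.rodWidth_pos
  have h4 := h.rodWidth_le
  refine union_subset (box_mono ?_ ?_) (box_mono ?_ ?_)
  · exact Ioo_subset_Ioo (by linarith) (by linarith)
  · exact Ioo_subset_Ioo (by nlinarith) (by nlinarith)
  · exact Ioo_subset_Ioo (by linarith) (by linarith)
  · exact Ioo_subset_Ioo (by nlinarith) (by nlinarith)

/-- The protrusion of a member of the tiling lies in a corridor and room of its parent, so it
misses all frames. -/
theorem frame_protrusion_disjoint (h : Admissible n b α) {k k' : ℤ} {w w' : Fin (n - 1) → ℤ}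
    {q q' : HypSpace n} (hq : q ∈ tileFrame n b α) (hq' : q' ∈ protrusion n b α Ioo)
    (e : h.tileMap k w • q = h.tileMap k' w' • q') : False := by
  have hb := h.four_le'
  have hb0 : (0 : ℝ) < b := by linarith
  have hB := h.protrusion_subset hq'
  have e2 : (b : ℝ) ^ k * q.1.2 = (b : ℝ) ^ k' * q'.1.2 := by
    rw [← tileMap_snd h k w, ← tileMap_snd h k' w', e]
  have hk : k = k' + 1 := by
    refine h.level_eq (t := q.1.2) (t' := q'.1.2 / b) hq.1.2 ⟨?_, ?_⟩ ?_
    · rw [lt_div_iff₀ hb0]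
      linarith [hB.2.1]
    · rw [div_lt_iff₀ hb0]
      exact hB.2.2
    · rw [e2, zpow_add_one₀ hb0.ne']
      field_simp
  subst hk
  have hk' : (b : ℝ) ^ k' ≠ 0 := (zpow_pos hb0 k').ne'
  have ht : b * q.1.2 = q'.1.2 := by
    rw [zpow_add_one₀ hb0.ne', mul_assoc] at e2
    exact mul_left_cancel₀ hk' e2
  have hx : ∀ i, b * (q.1.1 i + w i) = q'.1.1 i + w' i := fun i => by
    have e1 : (b : ℝ) ^ (k' + 1) * (q.1.1 i + w i) = (b : ℝ) ^ k' * (q'.1.1 i + w' i) := by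
      rw [← tileMap_fst h (k' + 1) w, ← tileMap_fst h k' w', e]
    rw [zpow_add_one₀ hb0.ne', mul_assoc] at e1
    exact mul_left_cancel₀ hk' e1
  -- the column of the parent
  have hv : ∀ i, 0 ≤ w' i - b * w i ∧ w' i - b * w i < b := fun i => by
    have hq1 := hq.1.1 i
    have hq1' := hB.1 i
    simp only [one_mul, Pi.zero_apply, sub_zero, mem_Ioo] at hq1 hq1'
    have := hx i
    have h1 : (-1 : ℝ) < w' i - b * w i := by nlinarith
    have h2 : (w' i : ℝ) - b * w i < b := by nlinarith
    have h1' : -1 < w' i - b * w i := by exact_mod_cast h1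
    have h2' : w' i - b * w i < b := by exact_mod_cast h2
    omega
  let v : Fin (n - 1) → Fin b := fun i => ⟨(w' i - b * w i).toNat, by have := hv i; omega⟩
  have hcell : ∀ i, cell v i = w' i - b * w i := fun i => by
    have : ((w' i - b * w i).toNat : ℤ) = w' i - b * w i := Int.toNat_of_nonneg (hv i).1
    change (((w' i - b * w i).toNat : ℕ) : ℝ) = _
    exact_mod_cast this
  have hvx : ∀ i, b * q.1.1 i - cell v i = q'.1.1 i := fun i => by
    rw [hcell]
    linarith [hx i]
  rcases hq' with hq' | hq'
  · refine (hq.2 v).1 ⟨fun i => ?_, ?_⟩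
    · have := hq'.1 i
      simp only [one_mul, Pi.zero_apply, sub_zero] at this
      rw [hvx]
      exact Ioo_subset_Icc_self this
    · have h1 := hq'.2.1
      have h2 := hq'.2.2
      rw [← ht] at h1 h2
      exact ⟨(lt_of_mul_lt_mul_left h1 hb0.le).le, (lt_of_mul_lt_mul_left h2 hb0.le).le⟩
  · refine (hq.2 v).2 ⟨fun i => ?_, ?_⟩
    · have := hq'.1 i
      simp only [one_mul, Pi.zero_apply, sub_zero] at this
      rw [hvx]
      exact Ioo_subset_Icc_self this
    · have h1 := hq'.2.1
      have h2 := hq'.2.2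
      rw [← ht] at h2
      exact ⟨hq.1.2.1.le, (lt_of_mul_lt_mul_left h2 hb0.le).le⟩

theorem tileMap_disjoint (h : Admissible n b α) {k k' : ℤ} {w w' : Fin (n - 1) → ℤ}
    (hne : ¬(k = k' ∧ w = w')) :
    Disjoint (h.tileMap k w • (tileFrame n b α ∪ protrusion n b α Ioo))
      (h.tileMap k' w' • (tileFrame n b α ∪ protrusion n b α Ioo)) := by
  have hb := h.four_le'
  have hb0 : (0 : ℝ) < b := by linarith
  refine disjoint_left.2 ?_
  rintro _ ⟨q, hq, rfl⟩ ⟨q', hq', e⟩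
  have e : h.tileMap k' w' • q' = h.tileMap k w • q := e
  have e2 : (b : ℝ) ^ k * q.1.2 = (b : ℝ) ^ k' * q'.1.2 := by
    rw [← tileMap_snd h k w, ← tileMap_snd h k' w', e]
  have e1 : ∀ i, (b : ℝ) ^ k * (q.1.1 i + w i) = (b : ℝ) ^ k' * (q'.1.1 i + w' i) := fun i => by
    rw [← tileMap_fst h k w, ← tileMap_fst h k' w', e]
  have hshift : (∀ i, q.1.1 i ∈ Ioo (0 : ℝ) 1) → (∀ i, q'.1.1 i ∈ Ioo (0 : ℝ) 1) → k ≠ k' := by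
    rintro hx hx' rfl
    refine hne ⟨rfl, funext fun i => shift_eq (hx i) (hx' i) ?_⟩
    exact mul_left_cancel₀ (zpow_pos hb0 k).ne' (e1 i)
  rcases hq with hq | hq <;> rcases hq' with hq' | hq'
  · exact hshift (fun i => by simpa using hq.1.1 i) (fun i => by simpa using hq'.1.1 i)
      (h.level_eq hq.1.2 hq'.1.2 e2)
  · exact h.frame_protrusion_disjoint hq hq' e.symm
  · exact h.frame_protrusion_disjoint hq' hq e
  · have hB := h.protrusion_subset hq
    have hB' := h.protrusion_subset hq'
    have hdiv : ∀ t ∈ Ioo (b : ℝ) (b * b), t / b ∈ Ioo (1 : ℝ) b := fun t ht =>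
      ⟨by rw [lt_div_iff₀ hb0]; linarith [ht.1], by rw [div_lt_iff₀ hb0]; exact ht.2⟩
    refine hshift (fun i => by simpa using hB.1 i) (fun i => by simpa using hB'.1 i)
      (h.level_eq (hdiv _ hB.2) (hdiv _ hB'.2) ?_)
    rw [mul_div_assoc', e2, mul_div_assoc]

theorem exists_tiling (h : Admissible n b α) : ∃ T, IsTiling (tile n b α) T := by
  have hb := h.four_le'
  have hb0 : (0 : ℝ) < b := by linarith
  have hcongr : ∀ A ∈ {A | ∃ k w, A = h.tileMap k w • tile n b α},
      ∃ g : IsomGroup n, A = g • tile n b α := by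
    rintro _ ⟨k, w, rfl⟩
    exact ⟨_, rfl⟩
  refine ⟨{A | ∃ k w, A = h.tileMap k w • tile n b α}, ⟨hcongr, ?_⟩, hcongr, fun p => ?_⟩
  · rintro _ ⟨k, w, rfl⟩ _ ⟨k', w', rfl⟩ hne
    have hcl : ∀ g : IsomGroup n, g • tile n b α =
        closure (g • (tileFrame n b α ∪ protrusion n b α Ioo)) := fun g => by
      rw [h.tile_eq_closure]
      exact g.1.image_closure _
    have hop : ∀ g : IsomGroup n, IsOpen (g • (tileFrame n b α ∪ protrusion n b α Ioo)) :=
      fun g => g.1.isOpenMap _ ((isOpen_tileFrame n b α).union (isOpen_protrusion n b α))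
    change Disjoint (interior (h.tileMap k w • tile n b α))
      (interior (h.tileMap k' w' • tile n b α))
    rw [hcl, hcl]
    refine disjoint_interior_closure (hop _) (h.tileMap_disjoint ?_)
    rintro ⟨rfl, rfl⟩
    exact hne rfl
  · -- the box that contains `p`
    obtain ⟨k, hk⟩ := exists_mem_Ico_zpow p.2 (by linarith : (1 : ℝ) < b)
    have hbk : 0 < (b : ℝ) ^ k := zpow_pos hb0 k
    set w : Fin (n - 1) → ℤ := fun i => ⌊p.1.1 i / (b : ℝ) ^ k⌋ with hw
    set q : HypSpace n := ⟨(WithLp.toLp 2 fun i => p.1.1 i / (b : ℝ) ^ k - w i,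
      p.1.2 / (b : ℝ) ^ k), div_pos p.2 hbk⟩ with hq
    have hqi : ∀ i, q.1.1 i = p.1.1 i / (b : ℝ) ^ k - w i := fun i => rfl
    have hqt : q.1.2 = p.1.2 / (b : ℝ) ^ k := rfl
    have hqD : q ∈ box 1 0 (Icc 0 1) (Icc 1 (b : ℝ)) := by
      refine ⟨fun i => ?_, ?_, ?_⟩
      · have h1 := Int.floor_le (p.1.1 i / (b : ℝ) ^ k)
        have h2 := Int.lt_floor_add_one (p.1.1 i / (b : ℝ) ^ k)
        have h3 : w i = ⌊p.1.1 i / (b : ℝ) ^ k⌋ := rfl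
        rw [hqi, one_mul, Pi.zero_apply, sub_zero, h3]
        constructor <;> linarith
      · rw [hqt, le_div_iff₀ hbk]
        linarith [hk.1]
      · have := hk.2
        rw [zpow_add_one₀ hb0.ne'] at this
        rw [hqt, div_le_iff₀ hbk]
        linarith
    by_cases hv : ∀ v : Fin (n - 1) → Fin b,
        q ∉ box b (cell v) (Icc α (1 - α)) (Icc (1 + α) (b - α)) ∧
        q ∉ box b (cell v) (Icc (1 / 2 - rodWidth b α) (1 / 2 + rodWidth b α)) (Icc 1 (1 + α))
    · refine ⟨_, ⟨k, w, rfl⟩, q, Or.inl (h.mem_closure_tileFrame hqD hv), ?_⟩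
      refine Subtype.ext (Prod.ext (PiLp.ext fun i => ?_) ?_)
      · change (b : ℝ) ^ k * (q.1.1 i + w i) = _
        rw [hqi]
        field_simp
        ring
      · change (b : ℝ) ^ k * q.1.2 = _
        rw [hqt]
        field_simp
    · -- `p` lies in the protrusion of a child of this box
      push Not at hv
      obtain ⟨v, hv⟩ := hv
      set q' : HypSpace n := ⟨(WithLp.toLp 2 fun i => b * q.1.1 i - cell v i, b * q.1.2),
        mul_pos hb0 q.2⟩ with hq'
      have hqi' : ∀ i, q'.1.1 i = b * q.1.1 i - cell v i := fun i => rfl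
      have hqt' : q'.1.2 = b * q.1.2 := rfl
      have hP : q' ∈ protrusion n b α Icc := by
        by_cases hr : q ∈ box b (cell v) (Icc α (1 - α)) (Icc (1 + α) (b - α))
        · refine Or.inl ⟨fun i => ?_, ?_, ?_⟩
          · rw [hqi']
            simpa using hr.1 i
          · rw [hqt']
            exact mul_le_mul_of_nonneg_left hr.2.1 hb0.le
          · rw [hqt']
            exact mul_le_mul_of_nonneg_left hr.2.2 hb0.le
        · have hr := hv hr
          refine Or.inr ⟨fun i => ?_, ?_, ?_⟩
          · rw [hqi']
            simpa using hr.1 i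
          · rw [hqt']
            nlinarith [hr.2.1]
          · rw [hqt']
            exact mul_le_mul_of_nonneg_left hr.2.2 hb0.le
      refine ⟨_, ⟨k - 1, fun i => (v i : ℕ) + b * w i, rfl⟩, q', Or.inr hP, ?_⟩
      refine Subtype.ext (Prod.ext (PiLp.ext fun i => ?_) ?_)
      · change (b : ℝ) ^ (k - 1) * (q'.1.1 i + (((v i : ℕ) + b * w i : ℤ) : ℝ)) = _
        rw [hqi', hqi, zpow_sub_one₀ hb0.ne']
        unfold cell
        push_cast
        field_simp
        ring
      · change (b : ℝ) ^ (k - 1) * q'.1.2 = _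
        rw [hqt', hqt, zpow_sub_one₀ hb0.ne']
        field_simp

end Admissible

/-! ### The chambers of the tile -/

/-- The part of the tile frame that keeps away from its boundary. -/
def deepFrame (n b : ℕ) (α : ℝ) : Set (HypSpace n) :=
  frame n b (Icc (α / 4 / b) (1 - α / 4 / b)) (Icc (1 + α / 4) (b - α / 4))
    (Ioo (α / 2) (1 - α / 2)) (Ioo (1 + α / 2) (b - α / 2))
    (Ioo (1 / 2 - plugWidth b α) (1 / 2 + plugWidth b α)) (Iic (1 + α / 2))

/-- A room together with the inner half of its walls. -/
def chamber {b : ℕ} (α : ℝ) (v : Fin (n - 1) → Fin b) : Set (HypSpace n) :=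
  box b (cell v) (Ioo (α / 2) (1 - α / 2)) (Ioo (1 + α / 2) (b - α / 2))

/-- The opening in the floor of a chamber. -/
def plug {b : ℕ} (α : ℝ) (v : Fin (n - 1) → Fin b) : Set (HypSpace n) :=
  box b (cell v) (Ioo (1 / 2 - plugWidth b α) (1 / 2 + plugWidth b α)) {1 + α / 2}

/-- The interior of a room. -/
def core {b : ℕ} (α : ℝ) (v : Fin (n - 1) → Fin b) : Set (HypSpace n) :=
  box b (cell v) (Ioo α (1 - α)) (Ioo (1 + α) (b - α))

theorem abs_coord_sub_le (p q : HypSpace n) (i : Fin (n - 1)) :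
    |p.1.1 i - q.1.1 i| ≤ ‖p.1.1 - q.1.1‖ := by
  simpa using PiLp.norm_apply_le (p.1.1 - q.1.1) i

theorem norm_sq_le_of_coord {x : EuclideanSpace ℝ (Fin (n - 1))} {r : ℝ}
    (h : ∀ i, |x i| ≤ r) : ‖x‖ ^ 2 ≤ (n - 1 : ℕ) * r ^ 2 := by
  rw [EuclideanSpace.norm_sq_eq]
  have := Finset.sum_le_card_nsmul Finset.univ (fun i => ‖x i‖ ^ 2) (r ^ 2) fun i _ =>
    pow_le_pow_left₀ (norm_nonneg _) (h i) 2
  simpa using this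

theorem norm_sq_of_coord {x : EuclideanSpace ℝ (Fin (n - 1))} {r : ℝ}
    (h : ∀ i, x i = r) : ‖x‖ ^ 2 = (n - 1 : ℕ) * r ^ 2 := by
  rw [EuclideanSpace.norm_sq_eq]
  simp [h]

/-- Among the pairs of heights in `[T, B]`, the pair `T, B` is the furthest apart. -/
theorem corner_lt {T B t s x y : ℝ} (hT : 1 < T) (ht : t ∈ Icc T B) (hs : s ∈ Icc T B)
    (hx : 0 ≤ x) (hxy : x * (T * B) < y) :
    (x + (t - s) ^ 2) / (t * s) < (y + (T - B) ^ 2) / (T * B) := by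
  have hTB : 0 < T * B := mul_pos (by linarith) (by linarith [ht.1, ht.2])
  have ht1 : 1 < t := hT.trans_le ht.1
  have hs1 : 1 < s := hT.trans_le hs.1
  have hts : 0 < t * s := by positivity
  have hvert : (t - s) ^ 2 / (t * s) ≤ (T - B) ^ 2 / (T * B) := by
    rw [div_le_div_iff₀ hts hTB]
    have h7 : T * t ≤ B * s := by nlinarith [ht.1, ht.2, hs.1]
    have h8 : T * s ≤ B * t := by nlinarith [ht.1, hs.2, hs.1]
    linarith [mul_nonneg (sub_nonneg.2 h7) (sub_nonneg.2 h8)]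
  have hhor : x / (t * s) < y / (T * B) :=
    (div_le_self hx (by nlinarith)).trans_lt ((lt_div_iff₀ hTB).2 hxy)
  rw [add_div, add_div]
  exact add_lt_add_of_lt_of_le hhor hvert

/-- Replacement of one horizontal coordinate. -/
def setCoord (p : HypSpace n) (i : Fin (n - 1)) (x : ℝ) : HypSpace n :=
  ⟨(WithLp.toLp 2 (Function.update p.1.1 i x), p.1.2), p.2⟩

theorem setCoord_same (p : HypSpace n) (i : Fin (n - 1)) (x : ℝ) :
    (setCoord p i x).1.1 i = x := by simp [setCoord]

theorem setCoord_ne (p : HypSpace n) {i j : Fin (n - 1)} (h : j ≠ i) (x : ℝ) :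
    (setCoord p i x).1.1 j = p.1.1 j := by simp [setCoord, h]

theorem sep_setCoord_lt {p : HypSpace n} {i : Fin (n - 1)} {x r : ℝ} (hp : 1 ≤ p.1.2)
    (hr : |p.1.1 i - x| < r) : sep p (setCoord p i x) < r ^ 2 := by
  have hnorm : ‖p.1.1 - (setCoord p i x).1.1‖ ^ 2 = (p.1.1 i - x) ^ 2 := by
    rw [EuclideanSpace.norm_sq_eq, Finset.sum_eq_single i]
    · rw [PiLp.sub_apply, setCoord_same]
      simp
    · intro j _ hj
      rw [PiLp.sub_apply, setCoord_ne _ hj]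
      simp
    · simp
  have ht : (setCoord p i x).1.2 = p.1.2 := rfl
  rw [sep, hnorm, ht, sub_self, div_lt_iff₀ (by positivity)]
  have h1 : (p.1.1 i - x) ^ 2 < r ^ 2 := sq_lt_sq' (by linarith [(abs_lt.1 hr).1]) (abs_lt.1 hr).2
  nlinarith [mul_le_mul hp hp zero_le_one (by linarith), sq_nonneg r]

namespace Admissible

variable {b : ℕ} {α : ℝ}

/-- A small ball about a point of the deep frame stays inside the tile frame. -/
theorem deepFrame_deep (h : Admissible n b α) {p : HypSpace n} (hp : p ∈ deepFrame n b α)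
    {q : HypSpace n} (hq : sep p q < (plugWidth b α / (4 * b ^ 2)) ^ 2) : q ∈ tileFrame n b α := by
  have hb := h.four_le'
  have hb0 : (0 : ℝ) < b := by linarith
  have h0 := h.pos
  have h1 := h.le
  have h2 := h.plugWidth_le
  have hκ := h.plugWidth_pos
  have h4 := h.rodWidth_le
  obtain ⟨⟨hpx, hpt⟩, hpv⟩ := hp
  obtain ⟨a1, a2⟩ := abs_sub_lt_of_sep_lt (by positivity)
    (by rw [div_le_one (by positivity)]; nlinarith) hq
  -- the Euclidean distance is less than `κ / (2 b)`
  set d : ℝ := plugWidth b α / (2 * b) with hd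
  have hbd : b * d = plugWidth b α / 2 := by
    rw [hd]
    field_simp
  have hle : 2 * (plugWidth b α / (4 * b ^ 2)) * p.1.2 ≤ d := by
    have : p.1.2 ≤ b := by linarith [hpt.2]
    calc 2 * (plugWidth b α / (4 * b ^ 2)) * p.1.2 ≤ 2 * (plugWidth b α / (4 * b ^ 2)) * b := by
          gcongr
      _ = d := by
          rw [hd]
          field_simp
          norm_num
  have hd0 : 0 < d := by positivity
  have hdκ : d ≤ plugWidth b α / 2 := by nlinarith
  have hx : ∀ i, |p.1.1 i - q.1.1 i| < d := fun i =>
    ((abs_coord_sub_le p q i).trans_lt a1).trans_le hle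
  have ht : |p.1.2 - q.1.2| < d := a2.trans_le hle
  have hbx : ∀ i, |b * p.1.1 i - b * q.1.1 i| < plugWidth b α / 2 := fun i => by
    rw [← mul_sub, abs_mul, abs_of_pos hb0, ← hbd]
    exact mul_lt_mul_of_pos_left (hx i) hb0
  have he : d < α / 4 / b := by
    rw [lt_div_iff₀ hb0]
    linarith
  rw [abs_lt] at ht
  refine ⟨⟨fun i => ?_, ?_⟩, fun v => ⟨fun hv => ?_, fun hv => ?_⟩⟩
  · have h5 := hpx i
    have h6 := abs_lt.1 (hx i)
    simp only [one_mul, Pi.zero_apply, sub_zero, mem_Icc] at h5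
    simp only [one_mul, Pi.zero_apply, sub_zero, mem_Ioo]
    constructor <;> linarith
  · constructor <;> linarith [hpt.1, hpt.2]
  · refine (hpv v).1 ⟨fun i => ?_, ?_⟩
    · have h5 := hv.1 i
      have h6 := abs_lt.1 (hbx i)
      constructor <;> linarith [h5.1, h5.2]
    · constructor <;> linarith [hv.2.1, hv.2.2]
  · have h7 : ∀ i, b * p.1.1 i - cell v i ∈ Ioo (1 / 2 - plugWidth b α) (1 / 2 + plugWidth b α) :=
      fun i => by
        have h5 := hv.1 i
        have h6 := abs_lt.1 (hbx i)
        constructor <;> linarith [h5.1, h5.2]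
    rcases le_or_gt p.1.2 (1 + α / 2) with hlow | hhigh
    · exact (hpv v).2 ⟨h7, hlow⟩
    · refine (hpv v).1 ⟨fun i => ?_, hhigh, ?_⟩
      · constructor <;> linarith [(h7 i).1, (h7 i).2]
      · linarith [hv.2.2]

theorem isPreconnected_deepFrame (h : Admissible n b α) : IsPreconnected (deepFrame n b α) := by
  have hb := h.four_le'
  have hb0 : (0 : ℝ) < b := by linarith
  have h0 := h.pos
  have h1 := h.le
  have h2 := h.plugWidth_le
  have hk : ∀ k : Fin b, ((k : ℕ) : ℝ) + 1 ≤ b := fun k => by exact_mod_cast k.2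
  have hk0 : ∀ k : Fin b, (0 : ℝ) ≤ ((k : ℕ) : ℝ) := fun k => by positivity
  have he : b * (α / 4 / b) = α / 4 := by field_simp
  have hmem : ∀ (k : Fin b) (y : ℝ), α / 2 ≤ y → y ≤ 1 - α / 2 →
      (((k : ℕ) : ℝ) + y) / b ∈ Icc (α / 4 / b) (1 - α / 4 / b) := by
    intro k y hy1 hy2
    have := hk k
    have := hk0 k
    constructor
    · gcongr
      linarith
    · rw [div_le_iff₀ hb0, sub_mul, mul_comm (α / 4 / b) (b : ℝ), he]
      linarith
  refine isPreconnected_frame (ylo := α / 2) (yhi := 1 - α / 2) (top := b - α / 2)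
    (by have := h.four_le; omega) (convex_Icc _ _) (convex_Icc _ _) ?_ ?_ ordConnected_Ioo
    ordConnected_Ioo ?_ ?_ ?_ ?_ ?_ ?_ ?_ ?_ ?_ ?_ ?_
  · exact Ioo_subset_Ioo (by linarith) (by linarith)
  · exact Ioo_subset_Ioo (by linarith) (by linarith)
  · constructor <;> linarith
  · constructor <;> linarith
  · exact fun y hy => hy.1
  · exact fun y hy => hy.2
  · exact fun k => hmem k _ le_rfl (by linarith)
  · exact fun k => hmem k _ (by linarith) le_rfl
  · constructor <;> linarith
  · exact fun t ht => ht.2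
  · intro t ht
    have ht : t ≤ 1 + α / 2 := ht
    refine ⟨2, ⟨by linarith, by linarith⟩, by linarith⟩
  · intro t _ hlow
    exact le_of_forall_gt_imp_ge_of_dense fun c hc => by
      rcases lt_or_ge c (b - α / 2) with hc' | hc'
      · exact (hlow c ⟨hc, hc'⟩).le
      · exact (hlow 2 ⟨by linarith, by linarith⟩).le.trans (by linarith)
  · linarith

/-- Points of the columns, with margins, satisfy the bounds that define the deep frame. -/
theorem mem_box_of_column (h : Admissible n b α) {v : Fin (n - 1) → Fin b} {p : HypSpace n}
    (hx : ∀ i, b * p.1.1 i - cell v i ∈ Icc (α / 2) (1 - α / 2))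
    (ht : p.1.2 ∈ Icc (1 + α / 2) (b - α / 2)) :
    p ∈ box 1 0 (Icc (α / 4 / b) (1 - α / 4 / b)) (Icc (1 + α / 4) (b - α / 4)) := by
  have hb := h.four_le'
  have hb0 : (0 : ℝ) < b := by linarith
  have h0 := h.pos
  refine ⟨fun i => ?_, ?_⟩
  · have h1 := hx i
    have h2 : cell v i + 1 ≤ b := by
      unfold cell
      exact_mod_cast (v i).2
    have h3 : 0 ≤ cell v i := by
      unfold cell
      positivity
    have he : b * (α / 4 / b) = α / 4 := by field_simp
    simp only [one_mul, Pi.zero_apply, sub_zero, mem_Icc]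
    constructor
    · refine le_of_mul_le_mul_left ?_ hb0
      linarith [h1.1]
    · refine le_of_mul_le_mul_left ?_ hb0
      rw [mul_sub, he]
      linarith [h1.2]
  · constructor <;> linarith [ht.1, ht.2]

theorem eq_of_mem_columns {v v' : Fin (n - 1) → Fin b} {p : HypSpace n} {X Y : Set ℝ}
    (hX : X ⊆ Ioo 0 1) (hY : Y ⊆ Ioo 0 1) (hx : ∀ i, b * p.1.1 i - cell v i ∈ X)
    (hx' : ∀ i, b * p.1.1 i - cell v' i ∈ Y) : v = v' :=
  funext fun i => cell_eq_of_mem (hX (hx i)) (hY (hx' i))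

theorem frontier_chamber_subset (h : Admissible n b α) (v : Fin (n - 1) → Fin b) :
    frontier (chamber α v) ⊆ deepFrame n b α ∪ plug α v := by
  have hb := h.four_le'
  have h0 := h.pos
  have h1 := h.le
  have h2 := h.plugWidth_le
  intro p hp
  have hop : IsOpen (chamber α v) := isOpen_box isOpen_Ioo isOpen_Ioo
  rw [hop.frontier_eq] at hp
  obtain ⟨hcl, hout⟩ := hp
  have hcl : p ∈ box b (cell v) (Icc (α / 2) (1 - α / 2)) (Icc (1 + α / 2) (b - α / 2)) :=
    closure_minimal (box_mono Ioo_subset_Icc_self Ioo_subset_Icc_self)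
      (isClosed_box isClosed_Icc isClosed_Icc) hcl
  by_cases hP : p ∈ plug α v
  · exact Or.inr hP
  refine Or.inl ⟨h.mem_box_of_column hcl.1 hcl.2, fun v' => ⟨fun hv' => ?_, fun hv' => ?_⟩⟩
  · obtain rfl : v = v' := eq_of_mem_columns
      (Icc_subset_Ioo (by linarith) (by linarith)) (Ioo_subset_Ioo (by linarith) (by linarith))
      hcl.1 hv'.1
    exact hout hv'
  · obtain rfl : v = v' := eq_of_mem_columns
      (Icc_subset_Ioo (by linarith) (by linarith)) (Ioo_subset_Ioo (by linarith) (by linarith))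
      hcl.1 hv'.1
    exact hP ⟨hv'.1, le_antisymm hv'.2 hcl.2.1⟩

/-- A point of a plug is close to a point of the plane of the plug with a prescribed coordinate. -/
theorem exists_side_of_plug (h : Admissible n b α) {v : Fin (n - 1) → Fin b} {p : HypSpace n}
    (hp : p ∈ plug α v) {y r : ℝ} (hy : y ∈ Icc (α / 2) (1 - α / 2))
    (hr : |b * p.1.1 h.index - cell v h.index - y| < b * r) :
    ∃ q : HypSpace n, sep p q < r ^ 2 ∧ q.1.2 = 1 + α / 2 ∧
      (∀ i, b * q.1.1 i - cell v i ∈ Icc (α / 2) (1 - α / 2)) ∧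
      b * q.1.1 h.index - cell v h.index = y := by
  have hb := h.four_le'
  have hb0 : (0 : ℝ) < b := by linarith
  have h0 := h.pos
  have h1 := h.le
  have h2 := h.plugWidth_le
  have hpt : p.1.2 = 1 + α / 2 := hp.2
  set x : ℝ := (cell v h.index + y) / b with hx
  have hbx : b * x = cell v h.index + y := by
    rw [hx]
    field_simp
  refine ⟨setCoord p h.index x, sep_setCoord_lt (by linarith) ?_, hpt, fun i => ?_, ?_⟩
  · refine lt_of_mul_lt_mul_left ?_ hb0.le
    rw [← abs_of_pos hb0, ← abs_mul, abs_of_pos hb0, mul_sub, hbx, ← sub_sub]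
    exact hr
  · by_cases hi : i = h.index
    · subst hi
      rw [setCoord_same, hbx, add_sub_cancel_left]
      exact hy
    · rw [setCoord_ne _ hi]
      have := hp.1 i
      constructor <;> linarith [this.1, this.2]
  · rw [setCoord_same, hbx, add_sub_cancel_left]

theorem plug_near_tileFrame (h : Admissible n b α) {v : Fin (n - 1) → Fin b} {p : HypSpace n}
    (hp : p ∈ plug α v) :
    ∃ q ∈ tileFrame n b α, sep p q < (plugWidth b α / (4 * b ^ 2)) ^ 2 := by
  have hb := h.four_le'
  have hb0 : (0 : ℝ) < b := by linarith
  have h0 := h.pos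
  have h1 := h.le
  have h2 := h.plugWidth_le
  have hγ := h.rodWidth_pos
  have h4 := h.rodWidth_le
  have h5 := h.rodWidth_mul
  have hbr : b * (plugWidth b α / (4 * b ^ 2)) = 4 * rodWidth b α := by
    rw [← h5]
    field_simp
    norm_num
  -- a point beside the corridor
  obtain ⟨y, hy, hyr, hyγ⟩ : ∃ y ∈ Icc (α / 2) (1 - α / 2),
      |b * p.1.1 h.index - cell v h.index - y| < b * (plugWidth b α / (4 * b ^ 2)) ∧
      y ∉ Icc (1 / 2 - rodWidth b α) (1 / 2 + rodWidth b α) := by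
    have hpi := hp.1 h.index
    by_cases hc : b * p.1.1 h.index - cell v h.index ∈
        Icc (1 / 2 - rodWidth b α) (1 / 2 + rodWidth b α)
    · refine ⟨1 / 2 + 2 * rodWidth b α, ⟨by linarith, by linarith⟩, ?_, fun hI => ?_⟩
      · rw [hbr, abs_lt]
        constructor <;> linarith [hc.1, hc.2]
      · linarith [hI.2]
    · refine ⟨_, ⟨?_, ?_⟩, ?_, hc⟩
      · linarith [hpi.1]
      · linarith [hpi.2]
      · rw [sub_self, abs_zero, hbr]
        positivity
  obtain ⟨q, hq, hqt, hqx, hqy⟩ := h.exists_side_of_plug hp hy hyr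
  refine ⟨q, ⟨⟨fun i => ?_, ?_⟩, fun v' => ⟨fun hv' => ?_, fun hv' => ?_⟩⟩, hq⟩
  · have := (h.mem_box_of_column hqx (by rw [hqt]; constructor <;> linarith)).1 i
    have he : 0 < α / 4 / b := by positivity
    constructor <;> linarith [this.1, this.2]
  · rw [hqt]
    constructor <;> linarith
  · have := hv'.2.1
    rw [hqt] at this
    linarith
  · obtain rfl : v = v' := eq_of_mem_columns
      (Icc_subset_Ioo (by linarith) (by linarith)) (Icc_subset_Ioo (by linarith) (by linarith))
      hqx hv'.1
    have := hv'.1 h.index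
    rw [hqy] at this
    exact hyγ this

theorem plug_near_deepFrame (h : Admissible n b α) {v : Fin (n - 1) → Fin b} {p : HypSpace n}
    (hp : p ∈ plug α v) : ∃ q ∈ deepFrame n b α, sep p q < (2 * plugWidth b α / b) ^ 2 := by
  have hb := h.four_le'
  have hb0 : (0 : ℝ) < b := by linarith
  have h0 := h.pos
  have h1 := h.le
  have h2 := h.plugWidth_le
  have hκ := h.plugWidth_pos
  have hpi := hp.1 h.index
  obtain ⟨q, hq, hqt, hqx, hqy⟩ := h.exists_side_of_plug hp (y := 1 / 2 + plugWidth b α)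
    (r := 2 * plugWidth b α / b) ⟨by linarith, by linarith⟩ (by
      rw [mul_div_cancel₀ _ hb0.ne', abs_lt]
      constructor <;> linarith [hpi.1, hpi.2])
  refine ⟨q, ⟨h.mem_box_of_column hqx (by rw [hqt]; constructor <;> linarith),
    fun v' => ⟨fun hv' => ?_, fun hv' => ?_⟩⟩, hq⟩
  · have := hv'.2.1
    rw [hqt] at this
    exact lt_irrefl _ this
  · obtain rfl : v = v' := eq_of_mem_columns
      (Icc_subset_Ioo (by linarith) (by linarith)) (Ioo_subset_Ioo (by linarith) (by linarith))
      hqx hv'.1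
    have := hv'.1 h.index
    rw [hqy] at this
    exact lt_irrefl _ this.2

theorem core_deep (h : Admissible n b α) {v : Fin (n - 1) → Fin b} {p q : HypSpace n}
    (hp : p ∈ core α v) (hq : sep p q < (2 * plugWidth b α / b) ^ 2) : q ∈ chamber α v := by
  have hb := h.four_le'
  have hb0 : (0 : ℝ) < b := by linarith
  have h0 := h.pos
  have h1 := h.le
  have h2 := h.plugWidth_le
  have hκ := h.plugWidth_pos
  have h3 := h.plugWidth_mul
  obtain ⟨a1, a2⟩ := abs_sub_lt_of_sep_lt (by positivity)
    (by rw [div_le_one hb0]; linarith) hq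
  have hle : 2 * (2 * plugWidth b α / b) * p.1.2 ≤ 4 * plugWidth b α := by
    have : p.1.2 ≤ b := by linarith [hp.2.2]
    calc 2 * (2 * plugWidth b α / b) * p.1.2 ≤ 2 * (2 * plugWidth b α / b) * b := by gcongr
      _ = 4 * plugWidth b α := by
          field_simp
          norm_num
  have hx : ∀ i, |b * p.1.1 i - b * q.1.1 i| < α / 2 := fun i => by
    rw [← mul_sub, abs_mul, abs_of_pos hb0]
    have := ((abs_coord_sub_le p q i).trans_lt a1).trans_le hle
    nlinarith
  have ht := abs_lt.1 (a2.trans_le hle)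
  refine ⟨fun i => ?_, ?_⟩
  · have h5 := hp.1 i
    have h6 := abs_lt.1 (hx i)
    constructor <;> linarith [h5.1, h5.2]
  · constructor <;> linarith [hp.2.1, hp.2.2]

/-- Opposite corners of the deep frame are further apart than any two points of a chamber. -/
theorem deepFrame_large (h : Admissible n b α) : ∃ p ∈ deepFrame n b α, ∃ q ∈ deepFrame n b α,
    ∀ v : Fin (n - 1) → Fin b, ∀ p' ∈ chamber α v, ∀ q' ∈ chamber α v, sep p' q' < sep p q := by
  have hb := h.four_le'
  have hb0 : (0 : ℝ) < b := by linarith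
  have h0 := h.pos
  have h1 := h.le
  have h2 := h.plugWidth_le
  set e : ℝ := α / 4 / b with he
  have hbe : b * e = α / 4 := by
    rw [he]
    field_simp
  have he0 : 0 < e := by positivity
  have he1 : e ≤ 1 / 8 := by nlinarith
  have hcell0 : ∀ (v : Fin (n - 1) → Fin b) (i), 0 ≤ cell v i := fun v i => by
    unfold cell
    positivity
  have hcell1 : ∀ (v : Fin (n - 1) → Fin b) (i), cell v i + 1 ≤ b := fun v i => by
    unfold cell
    exact_mod_cast (v i).2
  -- in the outermost walls the coordinates belong to no chamber and no plug
  have hwall : ∀ (x : ℝ) (v : Fin (n - 1) → Fin b) (i), (x = e ∨ x = 1 - e) →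
      b * x - cell v i ∉ Ioo (α / 2) (1 - α / 2) := by
    rintro x v i (rfl | rfl) hx
    · linarith [hx.1, hcell0 v i]
    · rw [mul_sub, hbe] at hx
      linarith [hx.2, hcell1 v i]
  have hmem : ∀ p : HypSpace n, (∀ i, p.1.1 i = e ∨ p.1.1 i = 1 - e) →
      p.1.2 ∈ Icc (1 + α / 4) (b - α / 4) → p ∈ deepFrame n b α := by
    intro p hp ht
    refine ⟨⟨fun i => ?_, ht⟩, fun v => ⟨fun hv => ?_, fun hv => ?_⟩⟩
    · rcases hp i with hi | hi <;> rw [hi] <;> simp only [one_mul, Pi.zero_apply, sub_zero] <;>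
        constructor <;> linarith
    · exact hwall _ v h.index (hp _) (hv.1 _)
    · refine hwall _ v h.index (hp _) (Ioo_subset_Ioo ?_ ?_ (hv.1 h.index)) <;> linarith
  set p : HypSpace n := ⟨(WithLp.toLp 2 fun _ => e, 1 + α / 4), by simp; linarith⟩ with hp
  set q : HypSpace n := ⟨(WithLp.toLp 2 fun _ => 1 - e, b - α / 4), by simp; linarith⟩ with hq
  have hpt : p.1.2 = 1 + α / 4 := rfl
  have hqt : q.1.2 = b - α / 4 := rfl
  refine ⟨p, hmem p (fun i => Or.inl rfl) ⟨hpt.ge, by rw [hpt]; linarith⟩,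
    q, hmem q (fun i => Or.inr rfl) ⟨by rw [hqt]; linarith, hqt.le⟩, fun v p' hp' q' hq' => ?_⟩
  have hpq : ‖p.1.1 - q.1.1‖ ^ 2 = (n - 1 : ℕ) * (2 * e - 1) ^ 2 :=
    norm_sq_of_coord fun i => by
      change e - (1 - e) = _
      ring
  have hpq' : ‖p'.1.1 - q'.1.1‖ ^ 2 ≤ (n - 1 : ℕ) * (1 / b) ^ 2 := by
    refine norm_sq_le_of_coord fun i => ?_
    have h5 := hp'.1 i
    have h6 := hq'.1 i
    rw [PiLp.sub_apply, abs_le, ← neg_div, div_le_iff₀ hb0, le_div_iff₀ hb0]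
    constructor <;> nlinarith [h5.1, h5.2, h6.1, h6.2]
  have hn : (1 : ℝ) ≤ (n - 1 : ℕ) := by
    have := h.two_le
    exact_mod_cast (by omega : 1 ≤ n - 1)
  have ht := hp'.2
  have hs := hq'.2
  rw [sep, sep, hpq, hpt, hqt]
  refine corner_lt (by linarith) ⟨by linarith [ht.1], by linarith [ht.2]⟩
    ⟨by linarith [hs.1], by linarith [hs.2]⟩ (by positivity) ?_
  have h8 : (9 / 16 : ℝ) ≤ (2 * e - 1) ^ 2 := by nlinarith
  have h9 : (1 + α / 4) * (b - α / 4) ≤ 2 * b := by nlinarith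
  have h10 : (1 / b : ℝ) ^ 2 * (2 * b) ≤ 1 / 2 := by
    rw [div_pow, one_pow, div_mul_eq_mul_div, div_le_iff₀ (by positivity)]
    nlinarith
  calc ‖p'.1.1 - q'.1.1‖ ^ 2 * ((1 + α / 4) * (b - α / 4))
      ≤ ((n - 1 : ℕ) * (1 / b) ^ 2) * (2 * b) :=
        mul_le_mul hpq' h9 (mul_nonneg (by linarith) (by linarith)) (by positivity)
    _ = (n - 1 : ℕ) * ((1 / b : ℝ) ^ 2 * (2 * b)) := by ring
    _ ≤ (n - 1 : ℕ) * (1 / 2) := by gcongr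
    _ < (n - 1 : ℕ) * (2 * e - 1) ^ 2 := by
        have : (1 / 2 : ℝ) < (2 * e - 1) ^ 2 := by linarith
        gcongr

/-- Two vertical ways lead from a room to the ceiling of its chamber; their distance exceeds the
diameter of a plug. -/
theorem core_two_ways (h : Admissible n b α) (v : Fin (n - 1) → Fin b) :
    ∃ S₁ S₂ : Set (HypSpace n),
    (∀ S ∈ ({S₁, S₂} : Set (Set (HypSpace n))), IsPreconnected S ∧
      S ⊆ chamber α v ∪ deepFrame n b α ∧ (S ∩ core α v).Nonempty ∧
      (S ∩ deepFrame n b α).Nonempty) ∧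
    ∀ a₁ ∈ S₁, ∀ a₂ ∈ S₂, ∀ w : Fin (n - 1) → Fin b, ∀ b₁ ∈ plug α w, ∀ b₂ ∈ plug α w,
      sep b₁ b₂ < sep a₁ a₂ := by
  have hb := h.four_le'
  have hb0 : (0 : ℝ) < b := by linarith
  have h0 := h.pos
  have h1 := h.le
  have h2 := h.plugWidth_le
  have hκ := h.plugWidth_pos
  let S : ℝ → Set (HypSpace n) := fun y => box b (cell v) {y} (Icc 2 (b - α / 2))
  have hS : ∀ y ∈ Ioo α (1 - α), IsPreconnected (S y) ∧ S y ⊆ chamber α v ∪ deepFrame n b α ∧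
      (S y ∩ core α v).Nonempty ∧ (S y ∩ deepFrame n b α).Nonempty := by
    intro y hy
    have hceil : ∀ p ∈ S y, p.1.2 = b - α / 2 → p ∈ deepFrame n b α := by
      intro p hp hpt
      refine ⟨h.mem_box_of_column (v := v) (fun i => ?_) ?_, fun v' => ⟨fun hv' => ?_,
        fun hv' => ?_⟩⟩
      · have : b * p.1.1 i - cell v i = y := hp.1 i
        rw [this]
        constructor <;> linarith [hy.1, hy.2]
      · rw [hpt]
        constructor <;> linarith
      · have := hv'.2.2
        rw [hpt] at this
        exact lt_irrefl _ this
      · have : p.1.2 ≤ 1 + α / 2 := hv'.2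
        linarith
    have hpt : ∀ t : ℝ, t ∈ Icc 2 (b - α / 2) → ∃ p ∈ S y, p.1.2 = t := by
      intro t ht
      refine ⟨⟨(WithLp.toLp 2 fun i => (cell v i + y) / b, t), by simp; linarith [ht.1]⟩,
        ⟨fun i => ?_, ht⟩, rfl⟩
      change b * ((cell v i + y) / b) - cell v i = y
      field_simp
      ring
    refine ⟨isPreconnected_box (convex_singleton _) (convex_Icc _ _), fun p hp => ?_, ?_, ?_⟩
    · rcases hp.2.2.lt_or_eq with hlt | heq
      · refine Or.inl ⟨fun i => ?_, ?_, hlt⟩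
        · have : b * p.1.1 i - cell v i = y := hp.1 i
          rw [this]
          constructor <;> linarith [hy.1, hy.2]
        · linarith [hp.2.1]
      · exact Or.inr (hceil p hp heq)
    · obtain ⟨p, hp, hpt⟩ := hpt 2 ⟨le_rfl, by linarith⟩
      refine ⟨p, hp, fun i => ?_, ?_⟩
      · have : b * p.1.1 i - cell v i = y := hp.1 i
        rw [this]
        exact hy
      · rw [hpt]
        constructor <;> linarith
    · obtain ⟨p, hp, hpt⟩ := hpt (b - α / 2) ⟨by linarith, le_rfl⟩
      exact ⟨p, hp, hceil p hp hpt⟩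
  refine ⟨S (1 / 4), S (3 / 4), ?_, ?_⟩
  · rintro _ (rfl | rfl)
    · exact hS _ ⟨by linarith, by linarith⟩
    · exact hS _ ⟨by linarith, by linarith⟩
  · intro a₁ ha₁ a₂ ha₂ w b₁ hb₁ b₂ hb₂
    have hn : (1 : ℝ) ≤ (n - 1 : ℕ) := by
      have := h.two_le
      exact_mod_cast (by omega : 1 ≤ n - 1)
    have ha : ‖a₁.1.1 - a₂.1.1‖ ^ 2 = (n - 1 : ℕ) * (-1 / 2 / b) ^ 2 := by
      refine norm_sq_of_coord fun i => ?_
      have e₁ : b * a₁.1.1 i - cell v i = 1 / 4 := ha₁.1 i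
      have e₂ : b * a₂.1.1 i - cell v i = 3 / 4 := ha₂.1 i
      rw [PiLp.sub_apply, eq_div_iff hb0.ne']
      linarith
    have hbb : ‖b₁.1.1 - b₂.1.1‖ ^ 2 ≤ (n - 1 : ℕ) * (2 * plugWidth b α / b) ^ 2 := by
      refine norm_sq_le_of_coord fun i => ?_
      have h5 := hb₁.1 i
      have h6 := hb₂.1 i
      rw [PiLp.sub_apply, abs_le, ← neg_div, div_le_iff₀ hb0, le_div_iff₀ hb0]
      constructor <;> nlinarith [h5.1, h5.2, h6.1, h6.2]
    have hb₁t : b₁.1.2 = 1 + α / 2 := hb₁.2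
    have hb₂t : b₂.1.2 = 1 + α / 2 := hb₂.2
    have hκb : (2 * plugWidth b α / b) ^ 2 < (-1 / 2 / b) ^ 2 / (b * b) := by
      have h6 : (2 * plugWidth b α / b) ^ 2 * (b * b) = (α / 4) ^ 2 / b ^ 2 := by
        have h7 : 2 * plugWidth b α = α / 4 / b := by
          unfold plugWidth
          field_simp
          norm_num
        rw [h7]
        field_simp
      rw [lt_div_iff₀ (by positivity), h6, div_pow (-1 / 2 : ℝ)]
      have : (α / 4) ^ 2 < (-1 / 2) ^ 2 := by nlinarith
      exact div_lt_div_of_pos_right this (by positivity)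
    calc sep b₁ b₂ ≤ ‖b₁.1.1 - b₂.1.1‖ ^ 2 := by
          rw [sep, hb₁t, hb₂t, sub_self, div_le_iff₀ (by positivity)]
          nlinarith [sq_nonneg ‖b₁.1.1 - b₂.1.1‖, mul_nonneg h0.le (sq_nonneg ‖b₁.1.1 - b₂.1.1‖),
            mul_nonneg (sq_nonneg α) (sq_nonneg ‖b₁.1.1 - b₂.1.1‖)]
      _ ≤ (n - 1 : ℕ) * (2 * plugWidth b α / b) ^ 2 := hbb
      _ < (n - 1 : ℕ) * ((-1 / 2 / b) ^ 2 / (b * b)) := by gcongr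
      _ = ‖a₁.1.1 - a₂.1.1‖ ^ 2 / (b * b) := by rw [ha, mul_div_assoc]
      _ ≤ (‖a₁.1.1 - a₂.1.1‖ ^ 2 + (a₁.1.2 - a₂.1.2) ^ 2) / (a₁.1.2 * a₂.1.2) := by
          have := a₁.2
          have := a₂.2
          have h5 : a₁.1.2 ≤ b := by linarith [ha₁.2.2]
          have h6 : a₂.1.2 ≤ b := by linarith [ha₂.2.2]
          gcongr
          nlinarith [sq_nonneg (a₁.1.2 - a₂.1.2)]

theorem isChambered_tile (h : Admissible n b α) :
    IsChambered (tile n b α) (deepFrame n b α) (chamber α) (plug α)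
      (core α : (Fin (n - 1) → Fin b) → Set (HypSpace n))
      ((plugWidth b α / (4 * b ^ 2)) ^ 2) ((2 * plugWidth b α / b) ^ 2) where
  frame_deep _ hp _ hq := tileFrame_subset_interior n b α (h.deepFrame_deep hp hq)
  frame_conn := h.isPreconnected_deepFrame
  frontier_subset := h.frontier_chamber_subset
  plug_near_body _ _ hp := by
    obtain ⟨q, hq, hlt⟩ := h.plug_near_tileFrame hp
    exact ⟨q, tileFrame_subset_interior n b α hq, hlt⟩
  plug_near_frame _ _ hp := h.plug_near_deepFrame hp
  frame_large := h.deepFrame_large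
  core_conn _ := isPreconnected_box (convex_Ioo _ _) (convex_Ioo _ _)
  core_deep _ _ hp _ hq := h.core_deep hp hq
  depth_pos := by
    have := h.plugWidth_pos
    have := h.four_le'
    constructor <;> positivity
  two_ways := h.core_two_ways

end Admissible

/-! ### Volumes, and the density bound -/

/-- The closed box `[0, 1]ⁿ⁻¹ × [1, b]` whose images under the similarities `tileMap` tile. -/
def slab (n b : ℕ) : Set (HypSpace n) := box 1 0 (Icc 0 1) (Icc 1 b)

/-- The union of the cores of all chambers. -/
def cores (n b : ℕ) (α : ℝ) : Set (HypSpace n) := ⋃ v : Fin (n - 1) → Fin b, core α v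

theorem isOpen_cores (n b : ℕ) (α : ℝ) : IsOpen (cores n b α) :=
  isOpen_iUnion fun _ => isOpen_box isOpen_Ioo isOpen_Ioo

theorem isCompact_slab (n b : ℕ) : IsCompact (slab n b) := isCompact_box one_pos one_pos

theorem vol_slab_lt_top (n b : ℕ) : vol n (slab n b) < ∞ := by
  refine vol_lt_top (R := √((n - 1 : ℕ) * 1 ^ 2)) (a := 1) (c := b) one_pos fun p hp =>
    ⟨?_, hp.2.1, hp.2.2⟩
  refine Real.le_sqrt_of_sq_le (norm_sq_le_of_coord fun i => ?_)
  have := hp.1 i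
  simp only [one_mul, Pi.zero_apply, sub_zero, mem_Icc] at this
  rw [abs_le]
  constructor <;> linarith

namespace Admissible

variable {b : ℕ} {α : ℝ}

theorem vol_slab_pos (h : Admissible n b α) : 0 < vol n (slab n b) := by
  have hb := h.four_le'
  have ho : IsOpen (box 1 0 (Ioo 0 1) (Ioo 1 b) : Set (HypSpace n)) :=
    isOpen_box isOpen_Ioo isOpen_Ioo
  refine (vol_pos_of_isOpen ho
    ⟨⟨(WithLp.toLp 2 fun _ => 1 / 2, 2), two_pos⟩, fun i => ?_, ?_, ?_⟩).trans_le
    (measure_mono (box_mono Ioo_subset_Icc_self Ioo_subset_Icc_self))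
  · constructor <;> norm_num
  · norm_num
  · change (2 : ℝ) < b
    linarith

/-- The volume of the protrusion is small: `b` disjoint congruent copies of it fit into the slab. -/
theorem vol_protrusion (h : Admissible n b α) :
    b * vol n (protrusion n b α Icc) ≤ vol n (slab n b) := by
  have hb := h.four_le'
  have hb0 : (0 : ℝ) < b := by linarith
  have h0 := h.pos
  have h1 := h.le
  have h2 := h.plugWidth_le
  have h3 := h.rodWidth_pos
  have h4 := h.rodWidth_le
  let g : Fin b → IsomGroup n := fun j => aff (b : ℝ)⁻¹ (inv_pos.2 hb0)
    (WithLp.toLp 2 fun _ => ((j : ℕ) : ℝ))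
  have hg1 : ∀ j (q : HypSpace n) i, (g j • q).1.1 i = (b : ℝ)⁻¹ * (q.1.1 i + (j : ℕ)) :=
    fun _ _ _ => rfl
  have hg2 : ∀ j (q : HypSpace n), (g j • q).1.2 = (b : ℝ)⁻¹ * q.1.2 := fun _ _ => rfl
  have hP : protrusion n b α Icc ⊆ box 1 0 (Ioo 0 1) (Icc (b : ℝ) (b * b)) := by
    refine union_subset (box_mono ?_ ?_) (box_mono ?_ ?_)
    · exact Icc_subset_Ioo (by linarith) (by linarith)
    · exact Icc_subset_Icc (by nlinarith) (by nlinarith)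
    · exact Icc_subset_Ioo (by linarith) (by linarith)
    · exact Icc_subset_Icc (by nlinarith) (by nlinarith)
  have hx : ∀ q ∈ protrusion n b α Icc, ∀ i, q.1.1 i ∈ Ioo (0 : ℝ) 1 := fun q hq i => by
    simpa using (hP hq).1 i
  have hdisj : Pairwise (Function.onFun Disjoint fun j => g j • protrusion n b α Icc) := by
    intro j j' hjj
    refine disjoint_left.2 ?_
    rintro _ ⟨q, hq, rfl⟩ ⟨q', hq', e⟩
    have e1 : (b : ℝ)⁻¹ * (q'.1.1 h.index + (j' : ℕ)) = (b : ℝ)⁻¹ * (q.1.1 h.index + (j : ℕ)) := by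
      rw [← hg1, ← hg1]
      exact congrArg (fun z : HypSpace n => z.1.1 h.index) e
    have e2 := mul_left_cancel₀ (inv_ne_zero hb0.ne') e1
    have e3 : ((j' : ℕ) : ℤ) = (j : ℕ) :=
      shift_eq (hx q' hq' h.index) (hx q hq h.index) (by exact_mod_cast e2)
    exact hjj (Fin.ext (by exact_mod_cast e3.symm))
  have hmeas : ∀ j, MeasurableSet (g j • protrusion n b α Icc) := fun j =>
    (h.isCompact_protrusion.image (g j).1.continuous).isClosed.measurableSet
  calc b * vol n (protrusion n b α Icc)
      = ∑ j : Fin b, vol n (g j • protrusion n b α Icc) := by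
        have h1n : 1 ≤ n := by
          have := h.two_le
          omega
        simp only [vol_smul h1n, Finset.sum_const, Finset.card_univ, Fintype.card_fin,
          nsmul_eq_mul]
    _ = vol n (⋃ j, g j • protrusion n b α Icc) := by
        rw [measure_iUnion hdisj hmeas, tsum_fintype]
    _ ≤ vol n (slab n b) := by
        refine measure_mono (iUnion_subset fun j => ?_)
        rintro _ ⟨q, hq, rfl⟩
        have hj : ((j : ℕ) : ℝ) + 1 ≤ b := by exact_mod_cast j.2
        have hj0 : (0 : ℝ) ≤ (j : ℕ) := by positivity
        refine ⟨fun i => ?_, ?_, ?_⟩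
        · have := hx q hq i
          change 1 * ((b : ℝ)⁻¹ * (q.1.1 i + (j : ℕ))) - 0 ∈ Icc (0 : ℝ) 1
          rw [one_mul, sub_zero, inv_mul_eq_div]
          constructor
          · exact div_nonneg (by linarith [this.1]) hb0.le
          · rw [div_le_one hb0]
            linarith [this.2]
        · change 1 ≤ (b : ℝ)⁻¹ * q.1.2
          rw [inv_mul_eq_div, le_div_iff₀ hb0]
          linarith [(hP hq).2.1]
        · change (b : ℝ)⁻¹ * q.1.2 ≤ b
          rw [inv_mul_eq_div, div_le_iff₀ hb0]
          exact (hP hq).2.2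

/-- The tile consists of its protrusion and of walls outside the cores. -/
theorem vol_tile_le (n b : ℕ) (α : ℝ) :
    vol n (tile n b α) ≤ vol n (slab n b \ cores n b α) + vol n (protrusion n b α Icc) := by
  refine (measure_union_le _ _).trans (add_le_add_left (measure_mono ?_) _)
  have hsub : tileFrame n b α ⊆ slab n b \ cores n b α := by
    intro p hp
    refine ⟨box_mono Ioo_subset_Icc_self Ioo_subset_Icc_self hp.1, fun hc => ?_⟩
    obtain ⟨v, hv⟩ := mem_iUnion.1 hc
    exact (hp.2 v).1 (box_mono Ioo_subset_Icc_self Ioo_subset_Icc_self hv)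
  exact closure_minimal hsub
    ((isCompact_slab n b).isClosed.inter (isOpen_cores n b α).isClosed_compl)

end Admissible

/-- As the walls become thinner, the cores fill the slab. -/
theorem exists_vol_slab_diff_lt {b : ℕ} (hb : 0 < b) {v : ℝ≥0∞} (hv : 0 < v) :
    ∃ α : ℝ, 0 < α ∧ α ≤ 1 / 16 ∧ vol n (slab n b \ cores n b α) < v := by
  have hb0 : (0 : ℝ) < b := by exact_mod_cast hb
  let a : ℕ → ℝ := fun j => 1 / 16 / (j + 1)
  have ha0 : ∀ j, 0 < a j := fun j => by positivity
  have ha1 : ∀ j, a j ≤ 1 / 16 := fun j => div_le_self (by norm_num) (by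
    have : (0 : ℝ) ≤ j := by positivity
    linarith)
  have hanti : Antitone a := fun j k hjk => by
    have : (j : ℝ) ≤ k := by exact_mod_cast hjk
    simp only [a]
    gcongr
  have hlim : Tendsto a atTop (𝓝 0) := by
    have := (tendsto_const_div_atTop_nhds_zero_nat (1 / 16 : ℝ)).comp (tendsto_add_atTop_nat 1)
    simpa [a, Function.comp_def] using this
  have hdecr : Antitone fun j => slab n b \ cores n b (a j) := by
    intro j k hjk
    have hle := hanti hjk
    refine sdiff_subset_sdiff_right (iUnion_mono fun v => box_mono ?_ ?_)
    · exact Ioo_subset_Ioo hle (by linarith)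
    · exact Ioo_subset_Ioo (by linarith) (by linarith)
  have hmeas : ∀ j, NullMeasurableSet (slab n b \ cores n b (a j)) (vol n) := fun j =>
    ((isCompact_slab n b).isClosed.measurableSet.diff
      (isOpen_cores n b (a j)).measurableSet).nullMeasurableSet
  have hnull : vol n (⋂ j, slab n b \ cores n b (a j)) = 0 := by
    -- the points that belong to no core lie in finitely many hyperplanes
    have hN : vol n ({p | p.1.2 = 1} ∪ {p | p.1.2 = b} ∪
        ⋃ (i : Fin (n - 1)) (k : ℤ), {p : HypSpace n | p.1.1 i = k / b}) = 0 := by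
      refine measure_union_null (measure_union_null (vol_height_eq _) (vol_height_eq _)) ?_
      exact measure_iUnion_null fun i => measure_iUnion_null fun k => vol_coord_eq i _
    refine measure_mono_null (fun p hp => ?_) hN
    by_contra hpN
    simp only [mem_union, mem_iUnion, mem_ofPred_eq, not_or, not_exists] at hpN
    obtain ⟨⟨ht1, htb⟩, hpx⟩ := hpN
    have hpD := (mem_iInter.1 hp 0).1
    have hx01 : ∀ i, p.1.1 i ∈ Icc (0 : ℝ) 1 := fun i => by simpa using hpD.1 i
    have hne : ∀ (i) (k : ℤ), b * p.1.1 i ≠ k := fun i k e => hpx i k (by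
      rw [eq_div_iff hb0.ne', mul_comm]
      exact e)
    have hfloor : ∀ i, 0 ≤ ⌊b * p.1.1 i⌋ ∧ ⌊b * p.1.1 i⌋ < b := fun i => by
      have h1 : b * p.1.1 i ≤ b * 1 := mul_le_mul_of_nonneg_left (hx01 i).2 hb0.le
      have h2 := hne i b
      refine ⟨Int.floor_nonneg.2 (mul_nonneg hb0.le (hx01 i).1), ?_⟩
      rw [Int.floor_lt]
      rw [mul_one] at h1
      exact lt_of_le_of_ne h1 (by exact_mod_cast h2)
    let v : Fin (n - 1) → Fin b := fun i => ⟨⌊b * p.1.1 i⌋.toNat, by have := hfloor i; omega⟩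
    have hcell : ∀ i, b * p.1.1 i - cell v i = Int.fract (b * p.1.1 i) := fun i => by
      have h1 : (⌊b * p.1.1 i⌋.toNat : ℤ) = ⌊b * p.1.1 i⌋ := Int.toNat_of_nonneg (hfloor i).1
      have h2 : cell v i = ⌊b * p.1.1 i⌋ := by
        change ((⌊b * p.1.1 i⌋.toNat : ℕ) : ℝ) = _
        exact_mod_cast h1
      rw [h2]
      rfl
    have hfr : ∀ i, 0 < Int.fract (b * p.1.1 i) := fun i =>
      lt_of_le_of_ne (Int.fract_nonneg _) fun e => hne i ⌊b * p.1.1 i⌋ (by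
        have := Int.floor_add_fract (b * p.1.1 i)
        rw [← e, add_zero] at this
        exact this.symm)
    have ht1' : 0 < p.1.2 - 1 := sub_pos.2 (lt_of_le_of_ne hpD.2.1 (Ne.symm ht1))
    have htb' : 0 < b - p.1.2 := sub_pos.2 (lt_of_le_of_ne hpD.2.2 htb)
    have hsmall : ∀ᶠ j in atTop, (∀ i, a j < Int.fract (b * p.1.1 i) ∧
        a j < 1 - Int.fract (b * p.1.1 i)) ∧ a j < p.1.2 - 1 ∧ a j < b - p.1.2 := by
      refine (eventually_all.2 fun i => ?_).and ?_
      · exact (hlim.eventually (gt_mem_nhds (hfr i))).and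
          (hlim.eventually (gt_mem_nhds (sub_pos.2 (Int.fract_lt_one _))))
      · exact (hlim.eventually (gt_mem_nhds ht1')).and (hlim.eventually (gt_mem_nhds htb'))
    obtain ⟨j, hj1, hj2, hj3⟩ := hsmall.exists
    refine (mem_iInter.1 hp j).2 (mem_iUnion.2 ⟨v, fun i => ?_, ?_, ?_⟩)
    · rw [hcell]
      exact ⟨(hj1 i).1, by linarith [(hj1 i).2]⟩
    · linarith
    · linarith
  have hfin : vol n (slab n b \ cores n b (a 0)) ≠ ∞ :=
    ((measure_mono sdiff_subset).trans_lt (vol_slab_lt_top n b)).ne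
  have h := tendsto_measure_iInter_atTop hmeas hdecr ⟨0, hfin⟩
  rw [hnull] at h
  obtain ⟨j, hj⟩ := (h.eventually (gt_mem_nhds hv)).exists
  exact ⟨a j, ha0 j, ha1 j, hj⟩

/-- For many columns and thin walls the tile has small optimal density: its volume is small compared
to the volume of its cores, and the cores of disjoint copies are disjoint. -/
theorem exists_tile_optimalDensity_lt (hn : 2 ≤ n) {ε : ℝ} (hε : 0 < ε) :
    ∃ (b : ℕ) (α : ℝ), Admissible n b α ∧
      optimalDensity (tile n b α) < ENNReal.ofReal ε := by
  set ε' : ℝ := min ε 1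
  have hε' : 0 < ε' := lt_min hε one_pos
  have hε1 : ε' ≤ 1 := min_le_right _ _
  -- `b` makes the protrusion small, and then `α` makes the walls thin
  obtain ⟨b, hb⟩ := exists_nat_gt (max 4 (8 / ε'))
  have hb4 : (4 : ℝ) < b := (le_max_left _ _).trans_lt hb
  have hb0 : (0 : ℝ) < b := by linarith
  have hbε : 8 / ε' < b := (le_max_right _ _).trans_lt hb
  rw [div_lt_iff₀ hε'] at hbε
  have h4 : 4 ≤ b := by exact_mod_cast hb4.le
  have hVpos : 0 < vol n (slab n b) :=
    (⟨hn, h4, by norm_num, le_rfl⟩ : Admissible n b (1 / 16)).vol_slab_pos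
  set V : ℝ := (vol n (slab n b)).toReal with hV
  have hV0 : 0 < V := ENNReal.toReal_pos hVpos.ne' (vol_slab_lt_top n b).ne
  have hVeq : vol n (slab n b) = ENNReal.ofReal V :=
    (ENNReal.ofReal_toReal (vol_slab_lt_top n b).ne).symm
  obtain ⟨α, hα0, hα1, hα⟩ := exists_vol_slab_diff_lt (n := n) (b := b) (by omega)
    (v := ENNReal.ofReal (ε' / 8 * V)) (ENNReal.ofReal_pos.2 (by positivity))
  have h : Admissible n b α := ⟨hn, h4, hα0, hα1⟩
  refine ⟨b, α, h, ?_⟩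
  have hprot : vol n (protrusion n b α Icc) ≤ ENNReal.ofReal (ε' / 8 * V) := by
    have h1 := h.vol_protrusion
    rw [hVeq, ← ENNReal.ofReal_natCast, mul_comm,
      ← ENNReal.le_div_iff_mul_le (Or.inl (ENNReal.ofReal_pos.2 hb0).ne')
        (Or.inl ENNReal.ofReal_ne_top), ← ENNReal.ofReal_div_of_pos hb0] at h1
    refine h1.trans (ENNReal.ofReal_le_ofReal ?_)
    rw [div_le_iff₀ hb0]
    nlinarith
  have hcores : ENNReal.ofReal (7 / 8 * V) ≤ vol n (cores n b α) := by
    have h1 : vol n (slab n b) ≤ vol n (cores n b α) + vol n (slab n b \ cores n b α) := by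
      refine (measure_mono fun p hp => ?_).trans (measure_union_le _ _)
      by_cases hpc : p ∈ cores n b α
      · exact Or.inl hpc
      · exact Or.inr ⟨hp, hpc⟩
    have h2 : ENNReal.ofReal V ≤ vol n (cores n b α) + ENNReal.ofReal (1 / 8 * V) := by
      rw [← hVeq]
      refine h1.trans (add_le_add_right (hα.le.trans (ENNReal.ofReal_le_ofReal ?_)) _)
      nlinarith
    rw [show 7 / 8 * V = V - 1 / 8 * V by ring, ENNReal.ofReal_sub _ (by positivity)]
    exact tsub_le_iff_right.2 h2
  have htile : vol n (tile n b α) < ENNReal.ofReal (3 / 8 * ε' * V) := by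
    refine ((Admissible.vol_tile_le n b α).trans (add_le_add hα.le hprot)).trans_lt ?_
    rw [← ENNReal.ofReal_add (by positivity) (by positivity),
      ENNReal.ofReal_lt_ofReal_iff (by positivity)]
    nlinarith [mul_pos hε' hV0]
  obtain ⟨r, hr, hvr⟩ := exists_vol_thickening_lt h.isBody_tile.2.1 htile
  have hdens : ∀ μ : Measure (PackingSpace (tile n b α)),
      IsInvariantProbability μ → density μ ≤ ENNReal.ofReal (ε' / 2) := by
    intro μ hμ
    have h1 := density_mul_le hn (isOpen_cores n b α)
      (fun _ _ hgh => h.isChambered_tile.disjoint_core hgh) hr μ hμ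
    have hx : ENNReal.ofReal (7 / 8 * V) ≠ 0 := (ENNReal.ofReal_pos.2 (by positivity)).ne'
    refine (ENNReal.mul_le_mul_iff_left hx ENNReal.ofReal_ne_top).1 ?_
    calc density μ * ENNReal.ofReal (7 / 8 * V) ≤ density μ * vol n (cores n b α) := by gcongr
      _ ≤ ENNReal.ofReal (3 / 8 * ε' * V) := h1.trans hvr.le
      _ ≤ ENNReal.ofReal (ε' / 2 * (7 / 8 * V)) :=
          ENNReal.ofReal_le_ofReal (by nlinarith [mul_pos hε' hV0])
      _ = ENNReal.ofReal (ε' / 2) * ENNReal.ofReal (7 / 8 * V) :=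
          ENNReal.ofReal_mul (by positivity)
  refine (iSup₂_le hdens).trans_lt ((ENNReal.ofReal_lt_ofReal_iff hε).2 ?_)
  have := min_le_left ε 1
  linarith

end HypPacking

end

theorem theorem5p3 (n : ℕ) (hn : 2 ≤ n) (ε : ℝ) (hε : 0 < ε) :
    ∃ K : Set (HypPacking.HypSpace n), HypPacking.IsBody K ∧
      (∃ T : Set (Set (HypPacking.HypSpace n)), HypPacking.IsTiling K T) ∧
      HypPacking.optimalDensity K < ENNReal.ofReal ε := by
  obtain ⟨b, α, h, hlt⟩ := HypPacking.exists_tile_optimalDensity_lt hn hε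
  exact ⟨HypPacking.tile n b α, h.isBody_tile, h.exists_tiling, hlt⟩
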